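/- **Setting.** Let $\mathcal X\subset\mathbb R^{n_x}$ be open, let $f:\mathcal X\to\mathbb R^{n_x}$ and $g:\mathcal X\to\mathbb R^{n_x\times n_u}$ be smooth, and let $\Phi:[0,\infty)\to\mathcal X$ be the solution of $\dot x=f(x)+g(x)u(t)$ for a fixed input $u$ and a fixed initial state. Write $L_f\varphi=\frac{\partial\varphi}{\partial x}f$. Let $h$ be a random function on $\mathcal X$ with smooth realizations and $h\sim\mathcal{GP}(0,\kappa_0)$, and suppose that $L_gL_f^ih=0$ on $\mathcal X$ for all $0\le i<r$. Fix $0\le k<r$ and let $\kappa_k(x,x')=\mathrm{Cov}\big(L_f^kh(x),L_f^kh(x')\big)$. The output is $y(t)=h(\Phi(t))+\varepsilon(t)$, with $\varepsilon$ a bounded measurement noise and $\|\varepsilon\|_\infty=\sup_{t\ge0}|\varepsilon(t)|$. For $l>0$ let $\hat z$ solve the high-gain observer $$\dot{\hat z}_i=\hat z_{i+1}+l^ik_i(\hat z_1-y)\ (1\le i<r),\qquad \dot{\hat z}_r=l^rk_r(\hat z_1-y),$$ from a fixed initial state $\hat z(0)$ that does not depend on $l$, where $K=(k_1,\dots,k_r)^\top$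 is such that $A+KC$ is Hurwitz. Here $A$ is the $r\times r$ matrix with ones on the superdiagonal and zeros elsewhere, and $C=[1\ 0\cdots0]$. Let $0\le t_0<t_1<\cdots$ be sampling instants such that, up to the current time $t$, consecutive ones satisfy $\|\Phi(t_{j+1})-\Phi(t_j)\|\ge\tau$ for some fixed $\tau>0$. Let $\mathcal S_j=\{t_{j-(N-1)},\dots,t_j\}$. For a signal $w$, let $\mathcal E_{w,\mathcal S_j}$ be the Gaussian process posterior mean with kernel $\kappa_k$, noise variance $\sigma_n^2>0$ and data $(\Phi(t_i),w(t_i))$, $t_i\in\mathcal S_j$. That is, $\mathcal E_{w,\mathcal S_j}(x)=\boldsymbol\kappa(x)^\top(\boldsymbol{\mathcal K}+\sigma_n^2I_N)^{-1}\boldsymbol w$, where $\boldsymbol\kappa(x)=(\kappa_k(x,\Phi(t_i)))_i$, $\boldsymbol{\mathcal K}=(\kappa_k(\Phi(t_i),\Phi(t_m)))_{i,m}$ and $\boldsymbol w=(w(t_i))_i$. Let $(\sigma_k^{j})^2(x)=\kappa_k(x,x)-\boldsymbol\kappa(x)^\top(\boldsymbol{\mathcal K}+\sigma_n^2I_N)^{-1}\boldsymbol\kappa(x)$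 be the posterior variance, $\sigma_k^j\ge 0$ the posterior standard deviation, and let $\mu_k^j=\mathcal E_{L_f^kh,\mathcal S_j}$ be the posterior mean fitted to the exact values $L_f^kh(\Phi(t_i))$. For $\delta>0$ let $\mathcal T_j=\mathcal T_{\delta,t_{j-(N+1)},t_j}$ be the union of the closed balls of radius $\delta$ centred at $\Phi(s)$, $s\in[t_{j-(N+1)},t_j]$. **Theorem.** Let $\eta\in(0,1)$, $\rho>0$ and $t_\epsilon>0$. There exist $l^*>0$ and positive numbers $c_1,c_2,c_3$, which do not depend on $l$, on $j$, on $\varepsilon$, on $x$ or on the realization of $h$, such that the following holds for all $l\ge l^*$, all bounded noises $\varepsilon$, and each $j\ge N+1$ with $t_{j-(N+1)}>t_\epsilon$, $t_j\le t$ and $\mathcal T_j\subset\mathcal X$. Let $W_k^j$, $W_{\mu_k^j}$ and $W_{\sigma_k^{2,j}}$ be Lipschitz constants on $\mathcal T_j$ of $L_f^kh$, of $\mu_k^j$ and of $(\sigma_k^j)^2$ (the first two may depend on the realization), let $M(\rho,\mathcal T_j)$ be the least number of closed balls of radius $\rho$ with centres in $\mathcal T_j$ that cover $\mathcal T_j$,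 and put $$\beta(\rho)=2\log\frac{M(\rho,\mathcal T_j)}{\eta},\qquad \alpha(\rho)=(W_k^j+W_{\mu_k^j})\rho+\sqrt{\beta(\rho)\,W_{\sigma_k^{2,j}}\,\rho}.$$ Then, with probability at least $1-\eta$, $$\big|\mathcal E_{\hat z_{k+1},\mathcal S_j}(x)-L_f^kh(x)\big|\le\sqrt{\beta(\rho)}\,\sigma_k^{j}(x)+\alpha(\rho)+c_1N\max\{c_2l^k\|\varepsilon\|_\infty,\;c_3l^{k-r}\}\qquad\text{for all }x\in\mathcal T_j.$$ -/

import Mathlib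

open MeasureTheory ProbabilityTheory
open scoped NNReal ENNReal Matrix

noncomputable section

/-- The Lie derivative `L_F φ (x) = (∂φ/∂x) F(x)`.  The iterate `(lieDeriv F)^[k] φ` is `L_F^k φ`. -/
def lieDeriv {E : Type*} [NormedAddCommGroup E] [NormedSpace ℝ E]
    (F : E → E) (φ : E → ℝ) : E → ℝ :=
  fun x => fderiv ℝ φ x (F x)

/-- `x` is a (Carathéodory) solution of `ẋ = F(t, x)` on `[0, ∞)`: the right-hand side is integrable
along `x` on every `[0, T]`, and `x` is its integral.  This admits discontinuous inputs and noises. -/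
def IsODESolution {V : Type*} [NormedAddCommGroup V] [NormedSpace ℝ V]
    (F : ℝ → V → V) (x : ℝ → V) : Prop :=
  ∀ T : ℝ, 0 ≤ T →
    IntervalIntegrable (fun s => F s (x s)) volume 0 T ∧
      x T = x 0 + ∫ s in (0 : ℝ)..T, F s (x s)

/-- The tube of radius `δ` around the piece of the curve `Φ` over the time interval `[T₁, T₂]`. -/
def tube {E : Type*} [PseudoMetricSpace E] (Φ : ℝ → E) (δ T₁ T₂ : ℝ) : Set E :=
  ⋃ t ∈ Set.Icc T₁ T₂, Metric.closedBall (Φ t) δ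

/-- `‖w‖_∞ = sup_{t ≥ 0} |w(t)|`, for a bounded signal `w`. -/
def supNorm (w : ℝ → ℝ) : ℝ := sSup ((fun t => |w t|) '' Set.Ici 0)

/-! ### Gaussian processes and Gaussian process regression -/

/-- The random function `F` restricted to `S` is a Gaussian process with mean zero and
covariance kernel `κ`, that is, `F ∼ GP(0, κ)` on `S`. -/
structure IsCenteredGP {Ω E : Type*} [MeasurableSpace Ω] (P : Measure Ω) (S : Set E)
    (F : Ω → E → ℝ) (κ : E → E → ℝ) : Prop where
  gaussian : IsGaussianProcess (fun (x : S) ω => F ω x) P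
  mean_zero : ∀ x ∈ S, ∫ ω, F ω x ∂P = 0
  cov_eq : ∀ x ∈ S, ∀ x' ∈ S, cov[fun ω => F ω x, fun ω => F ω x'; P] = κ x x'

/-- The covariance kernel `κ_k` of the process `L_f^k h`. -/
def lieKernel {Ω E : Type*} [MeasurableSpace Ω] [NormedAddCommGroup E] [NormedSpace ℝ E]
    (P : Measure Ω) (f : E → E) (h : Ω → E → ℝ) (k : ℕ) (x x' : E) : ℝ :=
  cov[fun ω => (lieDeriv f)^[k] (h ω) x, fun ω => (lieDeriv f)^[k] (h ω) x'; P]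

/-- The Gram matrix of the kernel `κ` at the sample points `X`. -/
def gramMatrix {E : Type*} {N : ℕ} (κ : E → E → ℝ) (X : Fin N → E) : Matrix (Fin N) (Fin N) ℝ :=
  Matrix.of fun a b => κ (X a) (X b)

/-- The posterior mean at `x` given the data `(X, y)`, with kernel `κ` and noise variance `v`:
`κ(x)ᵀ (K + v I)⁻¹ y`.  This is the regressor fitted to the data. -/
def posteriorMean {E : Type*} {N : ℕ} (κ : E → E → ℝ) (v : ℝ) (X : Fin N → E)
    (y : Fin N → ℝ) (x : E) : ℝ :=
  (fun a => κ x (X a)) ⬝ᵥ ((gramMatrix κ X + v • (1 : Matrix (Fin N) (Fin N) ℝ))⁻¹ *ᵥ y)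

/-- The posterior variance at `x`: `κ(x,x) - κ(x)ᵀ (K + v I)⁻¹ κ(x)`. -/
def posteriorVar {E : Type*} {N : ℕ} (κ : E → E → ℝ) (v : ℝ) (X : Fin N → E) (x : E) : ℝ :=
  κ x x - (fun a => κ x (X a)) ⬝ᵥ
    ((gramMatrix κ X + v • (1 : Matrix (Fin N) (Fin N) ℝ))⁻¹ *ᵥ fun a => κ x (X a))

/-- The `a`-th of the `N` sampling instants `t_{j-(N-1)}, …, t_j` of the window that ends with
the `j`-th one (used for `j ≥ N + 1`, where the subtraction is exact). -/
def windowTime (s : ℕ → ℝ) (N j : ℕ) (a : Fin N) : ℝ := s (j - N + 1 + a)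

/-- `β(ρ) = 2 log (M(ρ, T) / η)`, with `M(ρ, T)` the `ρ`-covering number of `T`. -/
def betaBound {E : Type*} [PseudoEMetricSpace E] (ρ : ℝ≥0) (η : ℝ) (T : Set E) : ℝ :=
  2 * Real.log (((Metric.coveringNumber ρ T).toNat : ℝ) / η)

/-- `α(ρ) = (W_f + W_μ) ρ + √(β(ρ) W_{σ²} ρ)`. -/
def alphaBound (β : ℝ) (ρ Wf Wμ Wσ : ℝ≥0) : ℝ :=
  ((Wf : ℝ) + Wμ) * ρ + Real.sqrt (β * Wσ * ρ)

/-! ### The high-gain observer -/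

/-- The matrix `A` of the canonical observability form: ones on the superdiagonal. -/
def obsA (r : ℕ) : Matrix (Fin r) (Fin r) ℝ :=
  Matrix.of fun i j => if (j : ℕ) = (i : ℕ) + 1 then 1 else 0

/-- The row `C = [1 0 ⋯ 0]`. -/
def obsC (r : ℕ) : Fin r → ℝ := fun i => if (i : ℕ) = 0 then 1 else 0

/-- A real square matrix is Hurwitz if all its complex eigenvalues have negative real part. -/
def IsHurwitz {r : ℕ} (M : Matrix (Fin r) (Fin r) ℝ) : Prop :=
  ∀ z ∈ spectrum ℂ (M.map (algebraMap ℝ ℂ)), z.re < 0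

/-- The right-hand side `A ẑ + D_l K (C ẑ - y)` of the observer, with
`D_l = diag(l, l², …, l^r)`. -/
def observerField {r : ℕ} (K : Fin r → ℝ) (l y : ℝ) (z : Fin r → ℝ) : Fin r → ℝ :=
  obsA r *ᵥ z +
    (obsC r ⬝ᵥ z - y) • (Matrix.diagonal (fun i : Fin r => l ^ ((i : ℕ) + 1)) *ᵥ K)

end

/-!
The regression error splits into the error of the regressor fitted to the exact values
`L_f^k h (Φ t_i)` and the effect of replacing those values by observer states.

*Exact data.*  `L_f^k h` is again a centered Gaussian process, as Lie derivatives are limits of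
difference quotients and pointwise limits of centered Gaussian variables are centered Gaussian
(`hasLaw_gaussianReal_of_tendsto`).  At a point `x` the error `L_f^k h (x) - μ (x)` is therefore
Gaussian, with variance at most the posterior variance
(`IsCenteredGaussianOn.exists_hasLaw_sub_posteriorMean`).  A union bound over the centres of a
minimal `ρ`-cover, extended by the Lipschitz constants, bounds it uniformly
(`IsCenteredGaussianOn.exists_measure_le_uniform_bound`).

*Observer data.*  Since `L_g L_f^i h = 0` for `i < r`, the functions `L_f^i h (Φ t)` form a chain of
integrators driven by `L_f^r h (Φ t)`.  Scaling the observer error by powers of `l` turns it into a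
linear system with the Hurwitz matrix `l (A + K C)`, and variation of constants yields the terms
`l^k ‖ε‖` and `l^{k-r}` (`IsHurwitz.exists_observer_error_le`).  The weights of the regressor are
bounded by `√(κ(x, x) / σ_n²)` (`IsCenteredGaussianOn.abs_posteriorMean_sub_le`), and `κ(x, x)` is
bounded on the tubes because variances converge along with the variables.

*Constants independent of the realization.*  The constant in front of `l^{k-r}` has to dominate
`sup |L_f^i h (Φ s)|` over `i ≤ r` and `s ≤ t`, which is finite for every realization but not bounded
over the realizations.  The event that it exceeds a level `B` is paid for by the slack in the
Gaussian tail estimate: `P(|ξ| > b) < e^{-b²/2}` is strict for a standard normal `ξ` and `b > 0`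
(`gaussianTail_lt`), so the union bound leaves a positive part of `η` unused.  Since consecutive
sampled states are `τ` apart, only finitely many windows end before `t`
(`finite_setOf_sample_le`); the smallest slack among them is positive, and one level `B` serves all.
-/

/-! ### Chain rule and variation of constants for Carathéodory solutions -/

open Filter Topology Set in
/-- Fundamental theorem of calculus along an absolutely continuous curve `x = x(0) + ∫ F` with
merely integrable velocity.  No differentiation almost everywhere is needed: the defect
`φ(x(t)) - φ(x(0)) - ∫ p F` grows at most by a small multiple of `∫ ‖F‖` on short intervals, and the
local estimates are chained by continuous induction. -/
theorem integral_eq_of_hasFDerivAt_along {V W : Type*} [NormedAddCommGroup V] [NormedSpace ℝ V]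
    [CompleteSpace V] [NormedAddCommGroup W] [NormedSpace ℝ W] [CompleteSpace W]
    {φ : V → W} {p : ℝ → V →L[ℝ] W} {x F : ℝ → V} {T : ℝ} (hT : 0 ≤ T)
    (hF : IntervalIntegrable F volume 0 T)
    (hx : ∀ t ∈ Icc 0 T, x t = x 0 + ∫ s in (0 : ℝ)..t, F s)
    (hφ : ∀ t ∈ Icc 0 T, HasFDerivAt φ (p t) (x t)) (hp : ContinuousOn p (Icc 0 T)) :
    IntervalIntegrable (fun s => p s (F s)) volume 0 T ∧
      φ (x T) = φ (x 0) + ∫ s in (0 : ℝ)..T, p s (F s) := by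
  have sub : ∀ {a b : ℝ}, a ∈ Icc 0 T → b ∈ Icc 0 T → uIcc a b ⊆ uIcc 0 T := by
    intro a b ha hb
    rw [uIcc_of_le hT]; exact uIcc_subset_Icc ha hb
  have memT : T ∈ Icc 0 T := ⟨hT, le_rfl⟩
  have mem0 : (0 : ℝ) ∈ Icc 0 T := ⟨le_rfl, hT⟩
  -- integrability of `p F`
  obtain ⟨C, hC⟩ := isCompact_Icc.exists_bound_of_continuousOn hp
  have hpF : IntervalIntegrable (fun s => p s (F s)) volume 0 T := by
    rw [intervalIntegrable_iff_integrableOn_Ioc_of_le hT] at hF ⊢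
    have hpm : AEStronglyMeasurable p (volume.restrict (Ioc 0 T)) :=
      (hp.mono Ioc_subset_Icc_self).aestronglyMeasurable measurableSet_Ioc
    refine Integrable.mono' (hF.norm.const_mul C)
      ((ContinuousLinearMap.id ℝ (V →L[ℝ] W)).aestronglyMeasurable_comp₂ hpm
        hF.aestronglyMeasurable) ?_
    refine (ae_restrict_iff' measurableSet_Ioc).2 (.of_forall fun s hs => ?_)
    exact (p s).le_of_opNorm_le (hC s (Ioc_subset_Icc_self hs)) _
  have hI : ∀ {a b : ℝ}, a ∈ Icc 0 T → b ∈ Icc 0 T → IntervalIntegrable F volume a b :=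
    fun ha hb => hF.mono_set (sub ha hb)
  have hpI : ∀ {a b : ℝ}, a ∈ Icc 0 T → b ∈ Icc 0 T →
      IntervalIntegrable (fun s => p s (F s)) volume a b := fun ha hb => hpF.mono_set (sub ha hb)
  have hxsub : ∀ {a b : ℝ}, a ∈ Icc 0 T → b ∈ Icc 0 T → x b - x a = ∫ s in a..b, F s := by
    intro a b ha hb
    rw [hx a ha, hx b hb, add_sub_add_left_eq_sub,
      intervalIntegral.integral_interval_sub_left (hI mem0 hb) (hI mem0 ha)]
  have hxc : ContinuousOn x (Icc 0 T) := by
    have := intervalIntegral.continuousOn_primitive_interval' hF left_mem_uIcc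
    rw [uIcc_of_le hT] at this
    exact (continuousOn_const.add this).congr hx
  set H : ℝ → W := fun t => φ (x t) - φ (x 0) - ∫ s in (0 : ℝ)..t, p s (F s) with hH
  set n : ℝ → ℝ := fun t => ∫ s in (0 : ℝ)..t, ‖F s‖ with hn
  have hHc : ContinuousOn H (Icc 0 T) := by
    have h1 := intervalIntegral.continuousOn_primitive_interval' hpF left_mem_uIcc
    rw [uIcc_of_le hT] at h1
    refine ContinuousOn.sub (ContinuousOn.sub ?_ continuousOn_const) h1
    intro t ht
    exact (hφ t ht).continuousAt.comp_continuousWithinAt (hxc t ht)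
  have hnc : ContinuousOn n (Icc 0 T) := by
    have h1 := intervalIntegral.continuousOn_primitive_interval' hF.norm left_mem_uIcc
    rwa [uIcc_of_le hT] at h1
  -- continuous induction on `{t | ‖H t‖ ≤ 2 ε ∫₀ᵗ ‖F‖}`
  have key : ∀ ε > 0, ‖H T‖ ≤ 2 * ε * n T := by
    intro ε hε
    have hcl : IsClosed ({t | ‖H t‖ ≤ 2 * ε * n t} ∩ Icc 0 T) := by
      have := (isClosed_Icc : IsClosed (Icc 0 T)).isClosed_le hHc.norm (hnc.const_mul (2 * ε))
      rwa [show {t | ‖H t‖ ≤ 2 * ε * n t} ∩ Icc 0 T = {t ∈ Icc 0 T | ‖H t‖ ≤ 2 * ε * n t} by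
        ext; simp [and_comm]]
    refine hcl.Icc_subset_of_forall_exists_gt (by simp [hH, hn]) ?_ memT
    rintro a ⟨ha, ha0⟩ y hy
    have haI : a ∈ Icc 0 T := Ico_subset_Icc_self ha0
    have e1 : ∀ᶠ t in 𝓝[Icc 0 T] a, ‖φ (x t) - φ (x a) - p a (x t - x a)‖ ≤ ε * ‖x t - x a‖ :=
      (hxc a haI).eventually ((hφ a haI).isLittleO.def hε)
    have e2 : ∀ᶠ t in 𝓝[Icc 0 T] a, dist (p t) (p a) < ε :=
      (hp a haI).eventually (Metric.ball_mem_nhds _ hε)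
    obtain ⟨d, hd, hdd⟩ := Metric.mem_nhdsWithin_iff.1 (e1.and e2)
    set b := min (min y T) (a + d / 2) with hb
    have hab : a < b := by
      simp only [hb, lt_min_iff]; exact ⟨⟨hy, ha0.2⟩, by linarith⟩
    have hbI : b ∈ Icc 0 T := ⟨haI.1.trans hab.le, (min_le_left _ _).trans (min_le_right _ _)⟩
    have hbd : b ≤ a + d / 2 := min_le_right _ _
    have hmem : ∀ t ∈ Icc a b, t ∈ Metric.ball a d ∩ Icc 0 T := by
      intro t ht
      refine ⟨?_, haI.1.trans ht.1, ht.2.trans hbI.2⟩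
      rw [Metric.mem_ball, Real.dist_eq, abs_of_nonneg (by linarith [ht.1])]
      linarith [ht.2]
    refine ⟨b, ?_, hab, (min_le_left _ _).trans (min_le_left _ _)⟩
    have hnab : n b - n a = ∫ s in a..b, ‖F s‖ :=
      intervalIntegral.integral_interval_sub_left (hI mem0 hbI).norm (hI mem0 haI).norm
    have h1 : ‖x b - x a‖ ≤ n b - n a := by
      rw [hxsub haI hbI, hnab]
      exact intervalIntegral.norm_integral_le_integral_norm hab.le
    have hconst : IntervalIntegrable (fun s => p a (F s)) volume a b :=
      ⟨(p a).integrable_comp (hI haI hbI).1, (p a).integrable_comp (hI haI hbI).2⟩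
    have hHab : H b - H a = (φ (x b) - φ (x a) - p a (x b - x a)) +
        ∫ s in a..b, (p a (F s) - p s (F s)) := by
      rw [intervalIntegral.integral_sub hconst (hpI haI hbI),
        ContinuousLinearMap.intervalIntegral_comp_comm _ (hI haI hbI), ← hxsub haI hbI,
        ← intervalIntegral.integral_interval_sub_left (hpI mem0 hbI) (hpI mem0 haI)]
      simp only [hH]; abel
    have h2 : ‖∫ s in a..b, (p a (F s) - p s (F s))‖ ≤ ε * (n b - n a) := by
      rw [hnab, ← intervalIntegral.integral_const_mul]
      refine intervalIntegral.norm_integral_le_of_norm_le hab.le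
        (.of_forall fun s hs => ?_) ((hI haI hbI).norm.const_mul ε)
      have := (hdd (hmem s (Ioc_subset_Icc_self hs))).2
      rw [← sub_apply]
      refine ContinuousLinearMap.le_of_opNorm_le _ ?_ _
      rw [← dist_eq_norm, dist_comm]; exact this.le
    have h3 := (hdd (hmem b ⟨hab.le, le_rfl⟩)).1
    have h4 : ‖H b - H a‖ ≤ 2 * ε * (n b - n a) := by
      rw [hHab]
      refine (norm_add_le _ _).trans ?_
      have := mul_le_mul_of_nonneg_left h1 hε.le
      linarith
    have ha' : ‖H a‖ ≤ 2 * ε * n a := ha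
    have h5 : ‖H b‖ ≤ ‖H a‖ + ‖H b - H a‖ := by
      simpa using norm_add_le (H a) (H b - H a)
    show ‖H b‖ ≤ 2 * ε * n b
    linarith
  have hlim : Tendsto (fun ε : ℝ => 2 * ε * n T) (𝓝[>] 0) (𝓝 0) := by
    have : Tendsto (fun ε : ℝ => 2 * ε * n T) (𝓝 0) (𝓝 (2 * 0 * n T)) :=
      Continuous.tendsto (by fun_prop) 0
    simp only [mul_zero, zero_mul] at this
    exact this.mono_left nhdsWithin_le_nhds
  have hHT : H T = 0 := by
    rw [← norm_le_zero_iff]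
    exact ge_of_tendsto hlim (eventually_mem_nhdsWithin.mono fun ε hε => key ε hε)
  refine ⟨hpF, ?_⟩
  have := hHT
  simp only [hH] at this
  rw [sub_sub, sub_eq_zero] at this
  exact this

open Filter Topology Set in
/-- Variation of constants for `ξ̇ = l A ξ + d` with an exponentially stable `A` and a bounded
forcing term `d`, in integral form. -/
theorem norm_le_of_linear_integral_eq {V : Type*} [NormedAddCommGroup V] [NormedSpace ℂ V]
    [CompleteSpace V] (A : V →L[ℂ] V) {c γ : ℝ} (hγ : 0 < γ)
    (hA : ∀ t : ℝ, 0 ≤ t → ‖NormedSpace.exp ((t : ℂ) • A)‖ ≤ c * Real.exp (-(γ * t)))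
    {l T D : ℝ} (hl : 0 < l) (hT : 0 ≤ T) {ξ d : ℝ → V}
    (hint : IntervalIntegrable (fun s => (l : ℂ) • A (ξ s) + d s) volume 0 T)
    (hξ : ∀ t ∈ Icc 0 T, ξ t = ξ 0 + ∫ s in (0 : ℝ)..t, ((l : ℂ) • A (ξ s) + d s))
    (hd : ∀ s ∈ Icc 0 T, ‖d s‖ ≤ D) :
    ‖ξ T‖ ≤ c * Real.exp (-(γ * (l * T))) * ‖ξ 0‖ + c / (γ * l) * D := by
  have hc : 0 ≤ c := by
    have := (norm_nonneg _).trans (hA 0 le_rfl)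
    simpa using this
  have hD : 0 ≤ D := (norm_nonneg _).trans (hd 0 ⟨le_rfl, hT⟩)
  have hξc : ContinuousOn ξ (Icc 0 T) := by
    have := intervalIntegral.continuousOn_primitive_interval' hint left_mem_uIcc
    rw [uIcc_of_le hT] at this
    exact (continuousOn_const.add this).congr hξ
  set E : ℝ → (V →L[ℂ] V) := fun s => NormedSpace.exp (((l * (T - s) : ℝ) : ℂ) • A) with hE
  have hEd : ∀ s, HasDerivAt E (-(l : ℂ) • (E s * A)) s := by
    intro s
    have h1 := hasDerivAt_exp_smul_const A (((l * (T - s) : ℝ) : ℂ))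
    have h2 : HasDerivAt (fun s : ℝ => ((l * (T - s) : ℝ) : ℂ)) (-(l : ℂ)) s := by
      have : HasDerivAt (fun s : ℝ => l * (T - s)) (-l) s := by
        simpa using ((hasDerivAt_id s).const_sub T).const_mul l
      simpa using this.ofReal_comp
    exact h1.scomp s h2
  have hEc : Continuous E := continuous_iff_continuousAt.2 fun s => (hEd s).continuousAt
  set R := ContinuousLinearMap.restrictScalarsL ℂ V V ℝ ℝ with hR
  set q : ℝ → ℝ × V →L[ℝ] V := fun s =>
    (R (E s)).comp (ContinuousLinearMap.snd ℝ ℝ V) +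
      (ContinuousLinearMap.fst ℝ ℝ V).smulRight (R (-(l : ℂ) • (E s * A)) (ξ s)) with hq
  -- the chain rule is applied to `(s, v) ↦ exp (l (T - s) A) v` along `s ↦ (s, ξ s)`, where the
  -- drift `l A ξ` cancels
  have hder : ∀ t ∈ Icc 0 T, HasFDerivAt (fun z : ℝ × V => R (E z.1) z.2) (q t) (t, ξ t) := by
    intro t _
    have h1 : HasDerivAt (fun s => R (E s)) (R (-(l : ℂ) • (E t * A))) t :=
      R.hasFDerivAt.comp_hasDerivAt t (hEd t)
    have h2 : HasFDerivAt (fun z : ℝ × V => R (E z.1)) _ (t, ξ t) :=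
      HasFDerivAt.comp (f := Prod.fst) (t, ξ t) h1.hasFDerivAt hasFDerivAt_fst
    refine (h2.clm_apply hasFDerivAt_snd).congr_fderiv ?_
    refine ContinuousLinearMap.ext fun z => ?_
    simp [hq]
  have hqc : ContinuousOn q (Icc 0 T) := by
    have hEc' : ContinuousOn (fun s => R (E s)) (Icc 0 T) := (R.continuous.comp hEc).continuousOn
    have hEA : ContinuousOn (fun s => R (-(l : ℂ) • (E s * A))) (Icc 0 T) :=
      (R.continuous.comp ((hEc.mul (continuous_const (y := A))).const_smul
        (-(l : ℂ)))).continuousOn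
    refine (hEc'.clm_comp continuousOn_const).add ?_
    exact ((ContinuousLinearMap.smulRightL ℝ (ℝ × V) V
      (ContinuousLinearMap.fst ℝ ℝ V)).continuous.comp_continuousOn (hEA.clm_apply hξc))
  have hsub : ∀ t ∈ Icc 0 T, IntervalIntegrable (fun s => (l : ℂ) • A (ξ s) + d s) volume 0 t :=
    fun t ht => hint.mono_set (by
      rw [uIcc_of_le hT, uIcc_of_le ht.1]; exact Icc_subset_Icc_right ht.2)
  have hFint : ∀ t ∈ Icc 0 T, IntervalIntegrable
      (fun s => ((1, (l : ℂ) • A (ξ s) + d s) : ℝ × V)) volume 0 t := by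
    intro t ht
    have h1 : IntervalIntegrable (fun _ : ℝ => (1 : ℝ)) volume 0 t := intervalIntegrable_const
    exact ⟨h1.1.prodMk (hsub t ht).1, h1.2.prodMk (hsub t ht).2⟩
  have hx : ∀ t ∈ Icc 0 T, ((t, ξ t) : ℝ × V) = (0, ξ 0) +
      ∫ s in (0 : ℝ)..t, ((1, (l : ℂ) • A (ξ s) + d s) : ℝ × V) := by
    intro t ht
    have e1 := (ContinuousLinearMap.fst ℝ ℝ V).intervalIntegral_comp_comm (hFint t ht)
    have e2 := (ContinuousLinearMap.snd ℝ ℝ V).intervalIntegral_comp_comm (hFint t ht)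
    simp only [ContinuousLinearMap.coe_fst', ContinuousLinearMap.coe_snd'] at e1 e2
    refine Prod.ext ?_ ?_
    · rw [Prod.fst_add, ← e1]; simp
    · rw [Prod.snd_add, ← e2]; exact hξ t ht
  obtain ⟨-, h2⟩ := integral_eq_of_hasFDerivAt_along (x := fun t => (t, ξ t))
    (F := fun s => ((1, (l : ℂ) • A (ξ s) + d s) : ℝ × V)) hT (hFint T ⟨hT, le_rfl⟩) hx hder hqc
  have hq_apply : ∀ s, q s (1, (l : ℂ) • A (ξ s) + d s) = E s (d s) := by
    intro s
    simp [hq, hR]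
  simp only [hq_apply] at h2
  have hET : R (E T) (ξ T) = ξ T := by simp [hE, hR]
  have hE0 : ∀ s ∈ Icc 0 T, ‖E s‖ ≤ c * Real.exp (-(γ * (l * (T - s)))) := fun s hs =>
    hA _ (mul_nonneg hl.le (by linarith [hs.2]))
  rw [hET] at h2
  rw [h2]
  refine (norm_add_le _ _).trans (add_le_add ?_ ?_)
  · have := hE0 0 ⟨le_rfl, hT⟩
    rw [sub_zero] at this
    exact ContinuousLinearMap.le_of_opNorm_le (E 0) this (ξ 0)
  · have hprim : ∀ s : ℝ, HasDerivAt
        (fun s => c * D / (γ * l) * Real.exp (-(γ * (l * (T - s)))))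
        (c * Real.exp (-(γ * (l * (T - s)))) * D) s := by
      intro s
      have h3 : HasDerivAt (fun s => -(γ * (l * (T - s)))) (γ * l) s := by
        have := ((((hasDerivAt_id s).const_sub T).const_mul l).const_mul (-γ))
        simpa only [neg_mul, mul_neg, mul_one, neg_neg, id] using this
      refine (h3.exp.const_mul (c * D / (γ * l))).congr_deriv ?_
      field_simp
    have hcont : Continuous fun s => c * Real.exp (-(γ * (l * (T - s)))) * D := by fun_prop
    refine (intervalIntegral.norm_integral_le_of_norm_le hT (.of_forall fun s hs => ?_)
      (hcont.intervalIntegrable 0 T)).trans ?_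
    · have hs' := Ioc_subset_Icc_self hs
      exact (E s).le_of_opNorm_le_of_le (hE0 s hs') (hd s hs')
    · rw [intervalIntegral.integral_eq_sub_of_hasDerivAt (fun s _ => hprim s)
        (hcont.intervalIntegrable 0 T)]
      have : 0 ≤ c * D / (γ * l) * Real.exp (-(γ * (l * (T - 0)))) := by positivity
      have h4 : c / (γ * l) * D = c * D / (γ * l) := by ring
      simp only [sub_self, mul_zero, neg_zero, Real.exp_zero, mul_one]
      linarith

/-! ### Exponential decay for Hurwitz matrices -/

theorem exp_apply_of_apply_eq_smul {V : Type*} [NormedAddCommGroup V] [NormedSpace ℂ V]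
    [CompleteSpace V] {A : V →L[ℂ] V} {v : V} {z : ℂ} (h : A v = z • v) :
    NormedSpace.exp A v = Complex.exp z • v := by
  have hpow : ∀ n : ℕ, (A ^ n) v = z ^ n • v := by
    intro n
    induction n with
    | zero => simp
    | succ n ih => rw [pow_succ, mul_apply_eq_comp, h, map_smul, ih, smul_smul, pow_succ']
  have h1 := (NormedSpace.exp_series_hasSum_exp' (𝕂 := ℂ) A).mapL
    (ContinuousLinearMap.apply ℂ V v)
  have h2 := (NormedSpace.exp_series_hasSum_exp' (𝕂 := ℂ) z).smul_const v
  rw [← Complex.exp_eq_exp_ℂ] at h2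
  refine h1.unique ?_
  convert h2 using 2 with n
  simp [hpow, smul_smul]

/-- The spectral mapping inclusion `σ(exp A) ⊆ exp(σ(A))` in finite dimension: an eigenspace of
`exp A` is invariant under `A` and so contains an eigenvector of `A`. -/
theorem exists_hasEigenvalue_of_mem_spectrum_exp {V : Type*} [NormedAddCommGroup V]
    [NormedSpace ℂ V] [FiniteDimensional ℂ V] [CompleteSpace V] {A : V →L[ℂ] V} {μ : ℂ}
    (hμ : μ ∈ spectrum ℂ (NormedSpace.exp A)) :
    ∃ z : ℂ, Module.End.HasEigenvalue (A : V →ₗ[ℂ] V) z ∧ Complex.exp z = μ := by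
  set E := NormedSpace.exp A with hE
  have hcomm : Commute A E := (Commute.refl A).exp_right
  have hsp : μ ∈ spectrum ℂ (E : V →ₗ[ℂ] V) := by
    rw [spectrum.mem_iff] at hμ ⊢
    intro hu
    apply hμ
    have : IsUnit ((algebraMap ℂ (V →L[ℂ] V)) μ - E) := by
      obtain ⟨w, hw⟩ := hu
      refine ⟨⟨algebraMap ℂ (V →L[ℂ] V) μ - E, LinearMap.toContinuousLinearMap (w⁻¹ : (V →ₗ[ℂ] V)ˣ).1,
        ?_, ?_⟩, rfl⟩
      · ext v
        have := congrArg (fun L => L v) w.mul_inv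
        rw [hw] at this
        simpa using this
      · ext v
        have := congrArg (fun L => L v) w.inv_mul
        rw [hw] at this
        simpa using this
    exact this
  have hev : Module.End.HasEigenvalue (E : V →ₗ[ℂ] V) μ :=
    Module.End.hasEigenvalue_iff_mem_spectrum.2 hsp
  set S := Module.End.eigenspace (E : V →ₗ[ℂ] V) μ with hS
  have hinv : ∀ v ∈ S, (A : V →ₗ[ℂ] V) v ∈ S := by
    intro v hv
    rw [hS, Module.End.mem_eigenspace_iff] at hv ⊢
    have := congrArg (fun L : V →L[ℂ] V => L v) hcomm.eq
    simp only [mul_apply_eq_comp] at this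
    change E v = μ • v at hv
    change E (A v) = μ • A v
    rw [← this, hv, map_smul]
  have : Nontrivial S := Submodule.nontrivial_iff_ne_bot.2 hev
  obtain ⟨z, hz⟩ := Module.End.exists_eigenvalue ((A : V →ₗ[ℂ] V).restrict hinv)
  obtain ⟨w, hw⟩ := hz.exists_hasEigenvector
  have hw1 : A (w : V) = z • (w : V) := by
    have := congrArg Subtype.val hw.apply_eq_smul
    simpa using this
  have hw0 : (w : V) ≠ 0 := fun h => hw.2 (Subtype.ext h)
  refine ⟨z, Module.End.hasEigenvalue_of_hasEigenvector (x := (w : V))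
    ⟨Module.End.mem_eigenspace_iff.2 hw1, hw0⟩, ?_⟩
  have h1 : E (w : V) = Complex.exp z • (w : V) := exp_apply_of_apply_eq_smul hw1
  have h2 : E (w : V) = μ • (w : V) := Module.End.mem_eigenspace_iff.1 w.2
  rw [h1] at h2
  exact smul_left_injective ℂ hw0 h2

open Filter Topology Set in
/-- If all eigenvalues of `A` have negative real part, then `exp A` has spectral radius below `1`,
and Gelfand's formula gives exponential decay of `exp (t A)`. -/
theorem exists_norm_exp_le_of_re_neg {V : Type*} [NormedAddCommGroup V]
    [NormedSpace ℂ V] [FiniteDimensional ℂ V] [CompleteSpace V] [Nontrivial V] (A : V →L[ℂ] V)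
    (hA : ∀ z, Module.End.HasEigenvalue (A : V →ₗ[ℂ] V) z → z.re < 0) :
    ∃ c > 0, ∃ γ > 0, ∀ t : ℝ, 0 ≤ t →
      ‖NormedSpace.exp ((t : ℂ) • A)‖ ≤ c * Real.exp (-(γ * t)) := by
  -- the addition formulas for `NormedSpace.exp` are stated over `ℚ`
  let _ : NormedAlgebra ℚ (V →L[ℂ] V) := NormedAlgebra.restrictScalars ℚ ℂ _
  have hrad : spectralRadius ℂ (NormedSpace.exp A) < (1 : ℝ≥0) := by
    refine spectrum.spectralRadius_lt_of_forall_lt _ fun μ hμ => ?_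
    obtain ⟨z, hz, rfl⟩ := exists_hasEigenvalue_of_mem_spectrum_exp hμ
    rw [← NNReal.coe_lt_coe, coe_nnnorm, Complex.norm_exp]
    simpa using hA z hz
  have hlim := spectrum.pow_nnnorm_pow_one_div_tendsto_nhds_spectralRadius (NormedSpace.exp A)
  obtain ⟨n, hn1, hn0⟩ := ((hlim.eventually_lt_const hrad).and (eventually_gt_atTop 0)).exists
  have hn : ‖NormedSpace.exp A ^ n‖ < 1 := by
    have hn' : (0 : ℝ) < 1 / n := by positivity
    have h1 : (‖NormedSpace.exp A ^ n‖₊ : ℝ≥0∞) < 1 := by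
      by_contra! h
      exact absurd hn1 (not_lt.2 (by simpa using ENNReal.one_le_rpow h hn'))
    exact_mod_cast h1
  -- a positive contraction factor over a time step of length `n`
  obtain ⟨q, hq1, hq2⟩ := exists_between (max_lt hn one_pos)
  have hq0 : 0 < q := (le_max_right _ _).trans_lt hq1
  have hqn : ‖NormedSpace.exp A ^ n‖ ≤ q := (le_max_left _ _).trans hq1.le
  have hcont : Continuous fun t : ℝ => NormedSpace.exp ((t : ℂ) • A) :=
    NormedSpace.exp_continuous.comp (Complex.continuous_ofReal.smul continuous_const)
  obtain ⟨C, hC⟩ := (isCompact_Icc (a := (0 : ℝ)) (b := n)).exists_bound_of_continuousOn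
    hcont.continuousOn
  have hnR : (0 : ℝ) < n := by exact_mod_cast hn0
  have hC1 : 0 < C + 1 := by
    have := (norm_nonneg _).trans (hC 0 ⟨le_rfl, hnR.le⟩); linarith
  have hlog : Real.log q < 0 := Real.log_neg hq0 hq2
  refine ⟨(C + 1) / q, by positivity, -Real.log q / n, div_pos (by linarith) hnR, fun t ht => ?_⟩
  set m := ⌊t / n⌋₊ with hm
  have hm1 : m * (n : ℝ) ≤ t := by
    have := Nat.floor_le (div_nonneg ht hnR.le)
    rwa [le_div_iff₀ hnR] at this
  have hm2 : t < (m + 1) * (n : ℝ) := by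
    have := Nat.lt_floor_add_one (t / n)
    rwa [div_lt_iff₀ hnR] at this
  have hsplit : NormedSpace.exp ((t : ℂ) • A) =
      (NormedSpace.exp A ^ n) ^ m * NormedSpace.exp (((t - m * n : ℝ) : ℂ) • A) := by
    rw [← pow_mul, ← NormedSpace.exp_nsmul, ← NormedSpace.exp_add_of_commute]
    · congr 1
      rw [← Nat.cast_smul_eq_nsmul ℂ, ← add_smul]
      congr 1
      push_cast; ring
    · exact ((Commute.refl A).smul_right _).smul_left _
  have h1 : ‖(NormedSpace.exp A ^ n) ^ m‖ ≤ q ^ m :=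
    (norm_pow_le _ _).trans (pow_le_pow_left₀ (norm_nonneg _) hqn m)
  have h2 : ‖NormedSpace.exp (((t - m * n : ℝ) : ℂ) • A)‖ ≤ C + 1 :=
    (hC _ ⟨by linarith, by linarith⟩).trans (by linarith)
  have h3 : q ^ m ≤ 1 / q * Real.exp (-(-Real.log q / n * t)) := by
    rw [one_div, inv_mul_eq_div, le_div_iff₀ hq0, ← pow_succ, ← Real.rpow_natCast,
      Real.rpow_def_of_pos hq0, Real.exp_le_exp]
    have : t / n ≤ m + 1 := by rw [div_le_iff₀ hnR]; exact hm2.le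
    have h4 := mul_le_mul_of_nonpos_left this hlog.le
    calc Real.log q * ((m + 1 : ℕ) : ℝ) = Real.log q * (m + 1) := by push_cast; ring
      _ ≤ Real.log q * (t / n) := h4
      _ = _ := by ring
  rw [hsplit]
  calc _ ≤ q ^ m * (C + 1) := (norm_mul_le _ _).trans (mul_le_mul h1 h2 (norm_nonneg _) (by positivity))
    _ ≤ (1 / q * Real.exp (-(-Real.log q / n * t))) * (C + 1) := by gcongr
    _ = _ := by ring

theorem IsHurwitz.exists_norm_exp_le {r : ℕ} (hr : 0 < r) {M : Matrix (Fin r) (Fin r) ℝ}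
    (hM : IsHurwitz M) :
    ∃ c > 0, ∃ γ > 0, ∀ t : ℝ, 0 ≤ t →
      ‖NormedSpace.exp ((t : ℂ) • LinearMap.toContinuousLinearMap
        (Matrix.toLin' (M.map (algebraMap ℝ ℂ))))‖ ≤ c * Real.exp (-(γ * t)) := by
  have : Nonempty (Fin r) := ⟨⟨0, hr⟩⟩
  refine exists_norm_exp_le_of_re_neg _ fun z hz => hM z ?_
  have := hz.mem_spectrum
  rw [LinearMap.coe_toContinuousLinearMap] at this
  rwa [← Matrix.spectrum_toLin']

/-! ### The high-gain observer -/

theorem contDiffOn_lieDeriv_iterate {E : Type*} [NormedAddCommGroup E] [NormedSpace ℝ E]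
    {S : Set E} (hS : IsOpen S) {f : E → E} (hf : ContDiffOn ℝ (⊤ : ℕ∞) f S) {φ : E → ℝ}
    (hφ : ContDiffOn ℝ (⊤ : ℕ∞) φ S) (i : ℕ) :
    ContDiffOn ℝ (⊤ : ℕ∞) ((lieDeriv f)^[i] φ) S := by
  induction i with
  | zero => exact hφ
  | succ i ih =>
    rw [Function.iterate_succ_apply']
    exact (ih.fderiv_of_isOpen hS (by simp)).clm_apply hf

/-- A Carathéodory solution is continuous on `[0, T]`. -/
theorem IsODESolution.continuousOn {V : Type*} [NormedAddCommGroup V] [NormedSpace ℝ V]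
    {F : ℝ → V → V} {x : ℝ → V} (hx : IsODESolution F x) (T : ℝ) :
    ContinuousOn x (Set.Icc 0 T) := by
  rcases lt_or_ge T 0 with hT | hT
  · rw [Set.Icc_eq_empty (not_le.2 hT)]; exact continuousOn_empty _
  have := intervalIntegral.continuousOn_primitive_interval' (hx T hT).1 Set.left_mem_uIcc
  rw [Set.uIcc_of_le hT] at this
  exact (continuousOn_const.add this).congr fun t ht => (hx t ht.1).2

/-- Along the trajectory `φ ∘ Φ` is the integral of `(L_f φ) ∘ Φ` when `L_g φ = 0`. -/
theorem IsODESolution.eq_add_integral_lieDeriv {E U : Type*} [NormedAddCommGroup E]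
    [NormedSpace ℝ E] [CompleteSpace E] [NormedAddCommGroup U] [NormedSpace ℝ U] {S : Set E}
    (hS : IsOpen S) {f : E → E} {g : E → U →L[ℝ] E} {u : ℝ → U} {Φ : ℝ → E}
    (hΦS : ∀ t : ℝ, 0 ≤ t → Φ t ∈ S) (hΦ : IsODESolution (fun t x => f x + g x (u t)) Φ)
    {φ : E → ℝ} (hφ : ContDiffOn ℝ (⊤ : ℕ∞) φ S)
    (hg : ∀ x ∈ S, ∀ v, fderiv ℝ φ x (g x v) = 0) {T : ℝ} (hT : 0 ≤ T) :
    IntervalIntegrable (fun s => lieDeriv f φ (Φ s)) volume 0 T ∧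
      φ (Φ T) = φ (Φ 0) + ∫ s in (0 : ℝ)..T, lieDeriv f φ (Φ s) := by
  have hd : ContinuousOn (fderiv ℝ φ) S := hφ.continuousOn_fderiv_of_isOpen hS (by simp)
  obtain ⟨h1, h2⟩ := integral_eq_of_hasFDerivAt_along (φ := φ) (p := fun s => fderiv ℝ φ (Φ s))
    (x := Φ) (F := fun s => f (Φ s) + g (Φ s) (u s)) hT (hΦ T hT).1 (fun t ht => (hΦ t ht.1).2)
    (fun t ht => ((hφ.contDiffAt (hS.mem_nhds (hΦS t ht.1))).differentiableAt
      (by simp)).hasFDerivAt)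
    (hd.comp (hΦ.continuousOn T) fun t ht => hΦS t ht.1)
  have he : ∀ s ∈ Set.uIcc 0 T, fderiv ℝ φ (Φ s) (f (Φ s) + g (Φ s) (u s)) =
      lieDeriv f φ (Φ s) := by
    intro s hs
    rw [Set.uIcc_of_le hT] at hs
    rw [map_add, hg _ (hΦS s hs.1), add_zero, lieDeriv]
  refine ⟨h1.congr fun s hs => he s (Set.uIoc_subset_uIcc hs), ?_⟩
  rw [h2, intervalIntegral.integral_congr he]

theorem obsA_mulVec {r : ℕ} (v : Fin r → ℝ) (i : Fin r) :
    (obsA r *ᵥ v) i = if h : (i : ℕ) + 1 < r then v ⟨i + 1, h⟩ else 0 := by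
  simp only [obsA, Matrix.mulVec, dotProduct, Matrix.of_apply, ite_mul, one_mul, zero_mul]
  split_ifs with h
  · rw [Finset.sum_eq_single ⟨i + 1, h⟩]
    · simp
    · intro b _ hb
      rw [if_neg]
      exact fun h' => hb (Fin.ext h')
    · simp
  · refine Finset.sum_eq_zero fun b _ => if_neg ?_
    have := b.2; omega

theorem obsC_dotProduct {r : ℕ} (hr : 0 < r) (v : Fin r → ℝ) : obsC r ⬝ᵥ v = v ⟨0, hr⟩ := by
  simp only [obsC, dotProduct, ite_mul, one_mul, zero_mul]
  rw [Finset.sum_eq_single ⟨0, hr⟩]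
  · simp
  · intro b _ hb
    rw [if_neg]
    exact fun h' => hb (Fin.ext h')
  · simp

/-- In the scaled coordinates `ξ_i = l^{-(i+1)} (ẑ_i - z_i)`, numbered from `0`, the observer error
obeys `ξ̇ = l (A + K C) ξ - K ε - l^{-r} z_r e_{r-1}`. -/
theorem observerField_scaled {r : ℕ} (hr : 0 < r) (K zhat : Fin r → ℝ) {l : ℝ} (hl : 0 < l)
    (z : ℕ → ℝ) (ε : ℝ) (i : Fin r) :
    (l ^ ((i : ℕ) + 1))⁻¹ * (observerField K l (z 0 + ε) zhat i - z (i + 1)) =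
      l * ((obsA r + Matrix.vecMulVec K (obsC r)) *ᵥ
          fun j : Fin r => (l ^ ((j : ℕ) + 1))⁻¹ * (zhat j - z j)) i
        + (-(K i * ε) - if (i : ℕ) + 1 = r then (l ^ r)⁻¹ * z r else 0) := by
  have h0 : l ≠ 0 := hl.ne'
  rw [Matrix.add_mulVec, Matrix.vecMulVec_mulVec, Pi.add_apply, obsA_mulVec, obsC_dotProduct hr]
  simp only [observerField, Pi.add_apply, obsA_mulVec, obsC_dotProduct hr, Pi.smul_apply,
    Matrix.mulVec_diagonal, smul_eq_mul, MulOpposite.smul_eq_mul_unop, MulOpposite.unop_op]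
  have hi := i.2
  by_cases h : (i : ℕ) + 1 < r
  · have h' : ¬ (i : ℕ) + 1 = r := by omega
    simp only [h, h', dif_pos, if_false]
    field_simp
    ring
  · have h' : (i : ℕ) + 1 = r := by omega
    rw [dif_neg h, dif_neg h, if_pos h', h']
    field_simp
    ring

open Set in
/-- Error bound of the high-gain observer for a chain of integrators `z_0, …, z_r` that starts with
the output: the noise is amplified by `l^i`, the unmodelled derivative `z_r` is damped by `l^{i-r}`,
and the initial error decays like `e^{-γ l T}`.  Components are numbered from `0`, and the constants
depend on the gains only. -/
theorem IsHurwitz.exists_observer_error_le {r : ℕ} (hr : 0 < r) {K : Fin r → ℝ}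
    (hK : IsHurwitz (obsA r + Matrix.vecMulVec K (obsC r))) :
    ∃ c > 0, ∃ γ > 0, ∀ l : ℝ, 1 ≤ l → ∀ (z : ℕ → ℝ → ℝ) (ε : ℝ → ℝ) (zhat : ℝ → Fin r → ℝ)
      (T e B : ℝ), 0 ≤ T →
      (∀ i < r, ∀ t : ℝ, 0 ≤ t → IntervalIntegrable (z (i + 1)) volume 0 t ∧
        z i t = z i 0 + ∫ s in (0 : ℝ)..t, z (i + 1) s) →
      IsODESolution (fun t v => observerField K l (z 0 t + ε t) v) zhat →
      (∀ s ∈ Icc 0 T, |ε s| ≤ e) → (∀ s ∈ Icc 0 T, |z r s| ≤ B) →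
      ∀ i : Fin r, |zhat T i - z i T| ≤
        c * (l ^ (i : ℕ) * e + l ^ ((i : ℤ) - (r : ℤ)) * B +
          l ^ (i : ℕ) * Real.exp (-(γ * (l * T))) * ‖fun j : Fin r => zhat 0 j - z j 0‖) := by
  obtain ⟨c, hc, γ, hγ, hexp⟩ := hK.exists_norm_exp_le hr
  set M := obsA r + Matrix.vecMulVec K (obsC r) with hM
  set A := LinearMap.toContinuousLinearMap (Matrix.toLin' (M.map (algebraMap ℝ ℂ))) with hA
  refine ⟨c + c / γ * (‖K‖ + 1), by positivity, γ, hγ, ?_⟩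
  intro l hl1 z ε zhat T e B hT hz hzhat hε hB i
  have hl : 0 < l := by linarith
  have he : 0 ≤ e := (abs_nonneg _).trans (hε 0 ⟨le_rfl, hT⟩)
  have hB0 : 0 ≤ B := (abs_nonneg _).trans (hB 0 ⟨le_rfl, hT⟩)
  set ξ : ℝ → Fin r → ℂ := fun t j => (((l ^ ((j : ℕ) + 1))⁻¹ * (zhat t j - z j t) : ℝ) : ℂ)
    with hξdef
  set d : ℝ → Fin r → ℂ := fun t j =>
    ((-(K j * ε t) - if (j : ℕ) + 1 = r then (l ^ r)⁻¹ * z r t else 0 : ℝ) : ℂ) with hddef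
  set w : ℝ → Fin r → ℝ := fun t j =>
    (l ^ ((j : ℕ) + 1))⁻¹ * (observerField K l (z 0 t + ε t) (zhat t) j - z (j + 1) t) with hw
  have hfield : ∀ t, (l : ℂ) • A (ξ t) + d t = fun j => (w t j : ℂ) := by
    intro t
    ext j
    have h1 := RingHom.map_mulVec (algebraMap ℝ ℂ) M
      (fun j : Fin r => (l ^ ((j : ℕ) + 1))⁻¹ * (zhat t j - z j t)) j
    have h2 : A (ξ t) j = ((M *ᵥ
      fun j : Fin r => (l ^ ((j : ℕ) + 1))⁻¹ * (zhat t j - z j t)) j : ℝ) := by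
      rw [Complex.coe_algebraMap] at h1
      rw [h1]; rfl
    simp only [hw, Pi.add_apply, Pi.smul_apply, h2]
    rw [observerField_scaled hr K (zhat t) hl (fun n => z n t) (ε t) j]
    simp only [hddef, smul_eq_mul]
    push_cast
    rfl
  have hF : ∀ t : ℝ, 0 ≤ t → ∀ j : Fin r, IntervalIntegrable
      (fun s => observerField K l (z 0 s + ε s) (zhat s) j) volume 0 t := by
    intro t ht j
    have := (hzhat t ht).1
    exact ⟨(ContinuousLinearMap.proj (R := ℝ) (φ := fun _ : Fin r => ℝ) j).integrable_comp this.1,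
      (ContinuousLinearMap.proj (R := ℝ) (φ := fun _ : Fin r => ℝ) j).integrable_comp this.2⟩
  have hwi : ∀ t : ℝ, 0 ≤ t → ∀ j : Fin r,
      IntervalIntegrable (fun s => w s j) volume 0 t :=
    fun t ht j => ((hF t ht j).sub (hz j j.2 t ht).1).const_mul _
  have hwC : ∀ t : ℝ, 0 ≤ t → ∀ j : Fin r,
      IntervalIntegrable (fun s => (w s j : ℂ)) volume 0 t :=
    fun t ht j => ⟨(hwi t ht j).1.ofReal, (hwi t ht j).2.ofReal⟩
  have hwint : ∀ t : ℝ, 0 ≤ t →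
      IntervalIntegrable (fun s => (fun j => (w s j : ℂ) : Fin r → ℂ)) volume 0 t :=
    fun t ht => ⟨Integrable.of_eval fun j => (hwC t ht j).1, Integrable.of_eval fun j => (hwC t ht j).2⟩
  have hξ : ∀ t ∈ Icc 0 T, ξ t = ξ 0 + ∫ s in (0 : ℝ)..t, ((l : ℂ) • A (ξ s) + d s) := by
    intro t ht
    simp only [hfield]
    ext j
    have h1 := (ContinuousLinearMap.proj (R := ℂ) (φ := fun _ : Fin r => ℂ) j
      ).intervalIntegral_comp_comm (hwint t ht.1)
    have h2 := (ContinuousLinearMap.proj (R := ℝ) (φ := fun _ : Fin r => ℝ) j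
      ).intervalIntegral_comp_comm (hzhat t ht.1).1
    simp only [ContinuousLinearMap.proj_apply] at h1 h2
    rw [Pi.add_apply, ← h1, intervalIntegral.integral_ofReal]
    simp only [hw]
    rw [intervalIntegral.integral_const_mul,
      intervalIntegral.integral_sub (hF t ht.1 j) (hz j j.2 t ht.1).1, h2]
    have h3 := congrFun (hzhat t ht.1).2 j
    have h4 := (hz j j.2 t ht.1).2
    rw [Pi.add_apply] at h3
    simp only [hξdef]
    rw [h3, h4]
    push_cast
    ring
  have hdb : ∀ s ∈ Icc 0 T, ‖d s‖ ≤ ‖K‖ * e + (l ^ r)⁻¹ * B := by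
    intro s hs
    refine (pi_norm_le_iff_of_nonneg (by positivity)).2 fun j => ?_
    simp only [hddef, Complex.norm_real, Real.norm_eq_abs]
    refine (abs_sub _ _).trans (add_le_add ?_ ?_)
    · rw [abs_neg, abs_mul]
      exact mul_le_mul (norm_le_pi_norm K j) (hε s hs) (abs_nonneg _) (norm_nonneg _)
    · split_ifs
      · rw [abs_mul, abs_of_pos (by positivity : 0 < (l ^ r)⁻¹)]
        exact mul_le_mul_of_nonneg_left (hB s hs) (by positivity)
      · simp; positivity
  have hmain := norm_le_of_linear_integral_eq A hγ hexp hl hT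
    (by simp only [hfield]; exact hwint T hT) hξ hdb
  -- the initial error is not increased by the scaling, since `l ≥ 1`
  have h0 : ‖ξ 0‖ ≤ l⁻¹ * ‖fun j : Fin r => zhat 0 j - z j 0‖ := by
    refine (pi_norm_le_iff_of_nonneg (by positivity)).2 fun j => ?_
    simp only [hξdef, Complex.norm_real, Real.norm_eq_abs]
    rw [abs_mul, abs_of_pos (by positivity : 0 < (l ^ ((j : ℕ) + 1))⁻¹)]
    refine mul_le_mul ?_ (norm_le_pi_norm (fun j : Fin r => zhat 0 j - z j 0) j)
      (abs_nonneg _) (by positivity)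
    exact inv_anti₀ hl (le_self_pow₀ hl1 (by omega))
  have hi : |zhat T i - z i T| ≤ l ^ ((i : ℕ) + 1) * ‖ξ T‖ := by
    have h1 := norm_le_pi_norm (ξ T) i
    simp only [hξdef, Complex.norm_real, Real.norm_eq_abs] at h1
    rw [abs_mul, abs_of_pos (by positivity : 0 < (l ^ ((i : ℕ) + 1))⁻¹),
      inv_mul_le_iff₀ (by positivity)] at h1
    exact h1
  have hz1 : l ^ ((i : ℤ) - (r : ℤ)) = l ^ (i : ℕ) * (l ^ r)⁻¹ := by
    rw [zpow_sub₀ hl.ne', zpow_natCast, zpow_natCast, div_eq_mul_inv]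
  set Z := ‖fun j : Fin r => zhat 0 j - z j 0‖ with hZ
  have hZ0 : 0 ≤ Z := norm_nonneg _
  set X := Real.exp (-(γ * (l * T))) with hX
  have hX0 : 0 < X := Real.exp_pos _
  calc |zhat T i - z i T| ≤ l ^ ((i : ℕ) + 1) * ‖ξ T‖ := hi
    _ ≤ l ^ ((i : ℕ) + 1) * (c * X * (l⁻¹ * Z) + c / (γ * l) * (‖K‖ * e + (l ^ r)⁻¹ * B)) := by
      gcongr
      exact hmain.trans (by gcongr)
    _ = c / γ * ‖K‖ * (l ^ (i : ℕ) * e) + c / γ * (l ^ ((i : ℤ) - (r : ℤ)) * B)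
        + c * (l ^ (i : ℕ) * X * Z) := by
      rw [hz1, pow_succ]; field_simp; ring
    _ ≤ (c + c / γ * (‖K‖ + 1)) * (l ^ (i : ℕ) * e) +
        (c + c / γ * (‖K‖ + 1)) * (l ^ ((i : ℤ) - (r : ℤ)) * B) +
        (c + c / γ * (‖K‖ + 1)) * (l ^ (i : ℕ) * X * Z) := by
      have hk : 0 ≤ c / γ * ‖K‖ := by positivity
      have hcγ : 0 ≤ c / γ := by positivity
      gcongr
      · nlinarith
      · nlinarith
      · nlinarith
    _ = _ := by ring

/-! ### Centered Gaussian processes and their Lie derivatives -/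

open Filter Topology in
/-- A pointwise limit of centered Gaussian variables is centered Gaussian, and the
variances converge. -/
theorem hasLaw_gaussianReal_of_tendsto {Ω : Type*} [MeasurableSpace Ω] {P : Measure Ω}
    [IsProbabilityMeasure P] {Z : ℕ → Ω → ℝ} {Y : Ω → ℝ} {v : ℕ → ℝ≥0}
    (hv : ∀ n, HasLaw (Z n) (gaussianReal 0 (v n)) P)
    (hlim : ∀ ω, Tendsto (fun n => Z n ω) atTop (𝓝 (Y ω))) :
    ∃ V : ℝ≥0, HasLaw Y (gaussianReal 0 V) P ∧
      Tendsto (fun n => (v n : ℝ)) atTop (𝓝 (V : ℝ)) := by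
  have hYm : AEMeasurable Y P :=
    aemeasurable_of_tendsto_metrizable_ae atTop (fun n => (hv n).aemeasurable) (.of_forall hlim)
  have : IsProbabilityMeasure (P.map Y) := Measure.isProbabilityMeasure_map hYm
  have hchar : ∀ {X : Ω → ℝ}, AEMeasurable X P → ∀ t : ℝ,
      charFun (P.map X) t = ∫ ω, Complex.exp (t * X ω * Complex.I) ∂P := by
    intro X hX t
    rw [charFun_apply_real, integral_map hX (by fun_prop)]
  have hconv : ∀ t : ℝ, Tendsto (fun n => (Real.exp (-(v n * t ^ 2 / 2)) : ℂ)) atTop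
      (𝓝 (charFun (P.map Y) t)) := by
    intro t
    have h1 : ∀ n, (Real.exp (-(v n * t ^ 2 / 2)) : ℂ) =
        ∫ ω, Complex.exp (t * Z n ω * Complex.I) ∂P := by
      intro n
      rw [← hchar (hv n).aemeasurable, (hv n).map_eq, charFun_gaussianReal]
      push_cast
      congr 1
      ring
    simp only [h1]
    rw [hchar hYm]
    refine tendsto_integral_of_dominated_convergence (fun _ => (1 : ℝ)) (fun n => ?_)
      (integrable_const _) (fun n => .of_forall fun ω => ?_) (.of_forall fun ω => ?_)
    · have := (hv n).aemeasurable
      exact (by fun_prop : AEMeasurable (fun ω => Complex.exp (t * Z n ω * Complex.I))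
        P).aestronglyMeasurable
    · rw [← Complex.ofReal_mul, Complex.norm_exp_ofReal_mul_I]
    · have hc : Continuous fun x : ℝ => Complex.exp (t * x * Complex.I) := by fun_prop
      exact (hc.tendsto (Y ω)).comp (hlim ω)
  -- the limit characteristic function is nonzero near the origin, so the variances converge
  obtain ⟨t, ht0, ht⟩ : ∃ t : ℝ, 0 < t ∧ charFun (P.map Y) t ≠ 0 := by
    have hc : ContinuousAt (charFun (P.map Y)) 0 := continuous_charFun.continuousAt
    have h1 : charFun (P.map Y) 0 ≠ 0 := by simp
    have h2 := (hc.eventually_ne h1).filter_mono (nhdsWithin_le_nhds (s := Set.Ioi (0 : ℝ)))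
    obtain ⟨t, h3, h4⟩ := (h2.and eventually_mem_nhdsWithin).exists
    exact ⟨t, h4, h3⟩
  have hre : Tendsto (fun n => Real.exp (-(v n * t ^ 2 / 2))) atTop
      (𝓝 (charFun (P.map Y) t).re) := by
    have := (Complex.continuous_re.tendsto _).comp (hconv t)
    simpa only [Function.comp_def, Complex.ofReal_re] using this
  have him : charFun (P.map Y) t = ((charFun (P.map Y) t).re : ℂ) :=
    tendsto_nhds_unique (hconv t) ((Complex.continuous_ofReal.tendsto _).comp hre)
  have hLne : (charFun (P.map Y) t).re ≠ 0 := by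
    intro h0
    rw [h0] at him
    exact ht (by simpa using him)
  have hlog : Tendsto (fun n => (v n : ℝ)) atTop
      (𝓝 (Real.log (charFun (P.map Y) t).re * (-2 / t ^ 2))) := by
    have h1 := (hre.log hLne).mul_const (-2 / t ^ 2)
    refine h1.congr fun n => ?_
    rw [Real.log_exp]
    field_simp
  obtain ⟨V, hV⟩ : ∃ V : ℝ≥0, (V : ℝ) = Real.log (charFun (P.map Y) t).re * (-2 / t ^ 2) :=
    ⟨⟨_, ge_of_tendsto' hlog fun n => (v n).2⟩, rfl⟩
  rw [← hV] at hlog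
  refine ⟨V, ⟨hYm, Measure.ext_of_charFun (funext fun s => ?_)⟩, hlog⟩
  rw [charFun_gaussianReal]
  refine tendsto_nhds_unique (hconv s) ?_
  have h2 : Tendsto (fun n => Real.exp (-(v n * s ^ 2 / 2))) atTop
      (𝓝 (Real.exp (-(V * s ^ 2 / 2)))) := by
    refine (Real.continuous_exp.tendsto _).comp ?_
    exact ((hlog.mul_const _).div_const _).neg
  have h3 := (Complex.continuous_ofReal.tendsto _).comp h2
  have h4 : Complex.exp (s * (0 : ℝ) * Complex.I - V * s ^ 2 / 2) =
      (Real.exp (-(V * s ^ 2 / 2)) : ℂ) := by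
    push_cast
    simp only [mul_zero, zero_mul, zero_sub]
  rw [h4]
  exact h3

/-- All finite linear combinations of the values of `F` at points of `S` are centered Gaussian
variables (possibly degenerate). -/
def IsCenteredGaussianOn {Ω E : Type*} [MeasurableSpace Ω] (P : Measure Ω) (S : Set E)
    (F : Ω → E → ℝ) : Prop :=
  ∀ (ι : Type) [Fintype ι] (x : ι → E) (c : ι → ℝ), (∀ i, x i ∈ S) →
    ∃ v : ℝ≥0, HasLaw (fun ω => ∑ i, c i * F ω (x i)) (gaussianReal 0 v) P

theorem IsCenteredGP.isCenteredGaussianOn {Ω E : Type*} [MeasurableSpace Ω] {P : Measure Ω}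
    {S : Set E} {F : Ω → E → ℝ} {κ : E → E → ℝ} (h : IsCenteredGP P S F κ) :
    IsCenteredGaussianOn P S F := by
  intro ι _ x c hx
  have h1 := ((h.gaussian.comp_right fun i : ι => (⟨x i, hx i⟩ : S)).smul
    c).hasGaussianLaw_fun_sum (I := Finset.univ)
  simp only [Function.comp_apply, smul_eq_mul] at h1
  refine ⟨Var[fun ω => ∑ i, c i * F ω (x i); P].toNNReal, h1.aemeasurable, ?_⟩
  have hmean : ∫ ω, ∑ i, c i * F ω (x i) ∂P = 0 := by
    rw [integral_finsetSum _ fun i _ =>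
      ((h.gaussian.hasGaussianLaw_eval ⟨x i, hx i⟩).integrable.const_mul (c i))]
    refine Finset.sum_eq_zero fun i _ => ?_
    rw [integral_const_mul, h.mean_zero _ (hx i), mul_zero]
  rw [h1.map_eq_gaussianReal, hmean]

open Filter Topology in
/-- Lie derivatives are limits of difference quotients, which are linear combinations. -/
theorem IsCenteredGaussianOn.lieDeriv {Ω E : Type*} [MeasurableSpace Ω] {P : Measure Ω}
    [IsProbabilityMeasure P] [NormedAddCommGroup E] [NormedSpace ℝ E] {S : Set E} (hS : IsOpen S)
    {F : Ω → E → ℝ} (hF : IsCenteredGaussianOn P S F)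
    (hd : ∀ ω, ∀ x ∈ S, DifferentiableAt ℝ (F ω) x) (f : E → E) :
    IsCenteredGaussianOn P S (fun ω => _root_.lieDeriv f (F ω)) := by
  intro ι _ x c hx
  set a : ℕ → ℝ := fun n => n with ha
  have hta : Tendsto a atTop atTop := tendsto_natCast_atTop_atTop
  have hnear : ∀ᶠ n in atTop, ∀ i, x i + (a n)⁻¹ • f (x i) ∈ S := by
    refine eventually_all.2 fun i => ?_
    have h1 : Tendsto (fun n => x i + (a n)⁻¹ • f (x i)) atTop (𝓝 (x i + (0 : ℝ) • f (x i))) :=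
      (hta.inv_tendsto_atTop.smul_const _).const_add _
    rw [zero_smul, add_zero] at h1
    exact h1.eventually (hS.mem_nhds (hx i))
  obtain ⟨n₀, hn₀⟩ := eventually_atTop.1 hnear
  have hlaw : ∀ n, ∃ v : ℝ≥0, HasLaw (fun ω => ∑ i, c i * (a (n + n₀) •
      (F ω (x i + (a (n + n₀))⁻¹ • f (x i)) - F ω (x i)))) (gaussianReal 0 v) P := by
    intro n
    obtain ⟨v, hv⟩ := hF (ι ⊕ ι) (Sum.elim (fun i => x i + (a (n + n₀))⁻¹ • f (x i)) x)
      (Sum.elim (fun i => c i * a (n + n₀)) fun i => -(c i * a (n + n₀)))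
      (Sum.rec (hn₀ (n + n₀) (by omega)) hx)
    refine ⟨v, ?_⟩
    convert hv using 2 with ω
    rw [Fintype.sum_sum_type, ← Finset.sum_add_distrib]
    refine Finset.sum_congr rfl fun i _ => ?_
    simp only [Sum.elim_inl, Sum.elim_inr, smul_eq_mul]
    ring
  choose v hv using hlaw
  have hlim : ∀ ω, Tendsto (fun n => ∑ i, c i * (a (n + n₀) •
      (F ω (x i + (a (n + n₀))⁻¹ • f (x i)) - F ω (x i)))) atTop
      (𝓝 (∑ i, c i * _root_.lieDeriv f (F ω) (x i))) := by
    intro ω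
    refine tendsto_finsetSum _ fun i _ => ?_
    have h1 := (hd ω (x i) (hx i)).hasFDerivAt.lim (f (x i)) (c := a) (l := atTop)
      (tendsto_norm_atTop_atTop.comp hta)
    exact (h1.comp (tendsto_add_atTop_nat n₀)).const_mul (c i)
  obtain ⟨V, hV, -⟩ := hasLaw_gaussianReal_of_tendsto hv hlim
  exact ⟨V, hV⟩

theorem IsCenteredGaussianOn.lieDeriv_iterate {Ω E : Type*} [MeasurableSpace Ω] {P : Measure Ω}
    [IsProbabilityMeasure P] [NormedAddCommGroup E] [NormedSpace ℝ E] {S : Set E} (hS : IsOpen S)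
    {F : Ω → E → ℝ} (hF : IsCenteredGaussianOn P S F) (hd : ∀ ω, ContDiffOn ℝ (⊤ : ℕ∞) (F ω) S)
    {f : E → E} (hf : ContDiffOn ℝ (⊤ : ℕ∞) f S) (i : ℕ) :
    IsCenteredGaussianOn P S (fun ω => (_root_.lieDeriv f)^[i] (F ω)) := by
  induction i with
  | zero => exact hF
  | succ i ih =>
    simp only [Function.iterate_succ_apply']
    exact ih.lieDeriv hS (fun ω x hx => ((contDiffOn_lieDeriv_iterate hS hf (hd ω)
      i).contDiffAt (hS.mem_nhds hx)).differentiableAt (by simp)) f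

theorem IsCenteredGaussianOn.hasLaw_eval {Ω E : Type*} [MeasurableSpace Ω] {P : Measure Ω}
    {S : Set E} {F : Ω → E → ℝ} (hF : IsCenteredGaussianOn P S F) {x : E} (hx : x ∈ S) :
    ∃ v : ℝ≥0, HasLaw (fun ω => F ω x) (gaussianReal 0 v) P := by
  simpa using hF Unit (fun _ => x) (fun _ => 1) fun _ => hx

open Filter Topology in
/-- A process with continuous paths and centered Gaussian values has continuous, hence locally
bounded, variance. -/
theorem IsCenteredGaussianOn.exists_variance_le {Ω E : Type*} [MeasurableSpace Ω] {P : Measure Ω}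
    [IsProbabilityMeasure P] [TopologicalSpace E] [FirstCountableTopology E] {S T : Set E}
    {F : Ω → E → ℝ}
    (hF : IsCenteredGaussianOn P S F) (hc : ∀ ω, ContinuousOn (F ω) S) (hT : IsCompact T)
    (hTS : T ⊆ S) : ∃ C : ℝ, ∀ x ∈ T, Var[fun ω => F ω x; P] ≤ C := by
  have hcont : Continuous fun x : S => Var[fun ω => F ω x; P] := by
    refine continuous_iff_seqContinuous.2 fun x y hxy => ?_
    choose v hv using fun x : S => hF.hasLaw_eval x.2
    have hvar : ∀ x : S, Var[fun ω => F ω x; P] = v x := fun x => by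
      rw [(hv x).variance_eq, variance_id_gaussianReal]
    obtain ⟨V, hV, hlim⟩ := hasLaw_gaussianReal_of_tendsto (Y := fun ω => F ω y)
      (fun n => hv (x n)) fun ω =>
        ((continuousOn_iff_continuous_domRestrict.1 (hc ω)).tendsto y).comp hxy
    simp only [Function.comp_def, hvar]
    rw [show (v y : ℝ) = V by rw [← hvar, hV.variance_eq, variance_id_gaussianReal]]
    exact hlim
  have hcontOn : ContinuousOn (fun x => Var[fun ω => F ω x; P]) S :=
    continuousOn_iff_continuous_domRestrict.2 hcont
  obtain ⟨C, hC⟩ := hT.exists_bound_of_continuousOn (hcontOn.mono hTS)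
  exact ⟨C, fun x hx => (le_abs_self _).trans (hC x hx)⟩

/-- The two-sided tail `P(|ξ| > b)` of a standard normal variable `ξ`. -/
noncomputable def gaussianTail (b : ℝ) : ℝ := (gaussianReal 0 1).real {x | b < |x|}

theorem gaussianTail_nonneg (b : ℝ) : 0 ≤ gaussianTail b := measureReal_nonneg

open Set in
/-- The two-sided tail is `2 ∫_b^∞ φ = 2 e^{-b²/2} ∫_0^∞ φ(x) e^{-bx} dx`, and the last integral is
strictly below `1/2`. -/
theorem gaussianTail_lt {b : ℝ} (hb : 0 < b) : gaussianTail b < Real.exp (-(b ^ 2 / 2)) := by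
  set p : ℝ → ℝ := gaussianPDFReal 0 1 with hp
  have hp_int : Integrable p := integrable_gaussianPDFReal 0 1
  have hp_abs : ∀ x, p |x| = p x := fun x => by simp [hp, gaussianPDFReal]
  have hp_pos : ∀ x, 0 < p x := fun x => gaussianPDFReal_pos _ _ _ (by norm_num)
  have hmeas : MeasurableSet {x : ℝ | b < |x|} := measurableSet_lt measurable_const measurable_abs
  have h1 : gaussianTail b = 2 * ∫ x in Ioi 0, (Ioi b).indicator p x := by
    rw [gaussianTail, measureReal_def, gaussianReal_apply_eq_integral _ (by norm_num),
      ENNReal.toReal_ofReal (integral_nonneg fun x => (hp_pos x).le), ← integral_indicator hmeas,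
      ← integral_comp_abs]
    congr 1
    ext x
    by_cases h : b < |x| <;> simp only [indicator, h, hp_abs, mem_Ioi, mem_ofPred_eq, if_true, if_false]
  have h2 : 1 = 2 * ∫ x in Ioi 0, p x := by
    rw [← integral_comp_abs]
    simp only [hp_abs]
    exact (integral_gaussianPDFReal_eq_one 0 (by norm_num)).symm
  have hshift : ∀ x, p (x + b) = Real.exp (-(b ^ 2 / 2)) * (Real.exp (-(b * x)) * p x) := by
    intro x
    have : Real.exp (-(x + b) ^ 2 / 2) =
        Real.exp (-(b ^ 2 / 2)) * (Real.exp (-(b * x)) * Real.exp (-x ^ 2 / 2)) := by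
      rw [← Real.exp_add, ← Real.exp_add]; congr 1; ring
    simp only [hp, gaussianPDFReal, sub_zero, NNReal.coe_one, mul_one, this]
    ring
  have h3 : ∫ x in Ioi 0, (Ioi b).indicator p x = ∫ x in Ioi 0, p (x + b) := by
    rw [setIntegral_indicator measurableSet_Ioi, Ioi_inter_Ioi, sup_of_le_right hb.le,
      ← integral_indicator measurableSet_Ioi, ← integral_indicator measurableSet_Ioi,
      ← integral_add_right_eq_self _ b]
    congr 1
    ext x
    simp [indicator]
  have hshift_int : IntegrableOn (fun x => p (x + b)) (Ioi 0) := (hp_int.comp_add_right b).integrableOn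
  have h4 : 0 < ∫ x in Ioi 0, (Real.exp (-(b ^ 2 / 2)) * p x - p (x + b)) := by
    rw [setIntegral_pos_iff_support_of_nonneg_ae]
    · refine lt_of_lt_of_le (by simp : (0 : ℝ≥0∞) < volume (Ioi (0 : ℝ))) (measure_mono ?_)
      intro x hx
      refine ⟨?_, hx⟩
      rw [Function.mem_support, hshift]
      have h5 : Real.exp (-(b * x)) < 1 := Real.exp_lt_one_iff.2 (by
        have := mul_pos hb hx; linarith)
      have h6 := Real.exp_pos (-(b ^ 2 / 2))
      have : Real.exp (-(b * x)) * p x < p x := by nlinarith [hp_pos x]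
      exact (sub_pos.2 (mul_lt_mul_of_pos_left this h6)).ne'
    · refine (ae_restrict_iff' measurableSet_Ioi).2 (.of_forall fun x hx => ?_)
      have h5 : Real.exp (-(b * x)) ≤ 1 := Real.exp_le_one_iff.2 (by
        have := mul_pos hb hx; linarith)
      have : Real.exp (-(b * x)) * p x ≤ p x := by nlinarith [hp_pos x]
      simp only [Pi.zero_apply, hshift]
      exact sub_nonneg.2 (mul_le_mul_of_nonneg_left this (Real.exp_pos _).le)
    · exact (hp_int.integrableOn.const_mul _).sub hshift_int
  rw [integral_sub (hp_int.integrableOn.const_mul _) hshift_int, integral_const_mul] at h4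
  rw [h1, h3]
  nlinarith [Real.exp_pos (-(b ^ 2 / 2))]

/-- A centered Gaussian of variance at most `σ²` exceeds `b σ` in modulus with probability at most
the standard tail at `b`; the degenerate case is included. -/
theorem measure_lt_abs_le_gaussianTail {Ω : Type*} [MeasurableSpace Ω] {P : Measure Ω} {Z : Ω → ℝ}
    {v : ℝ≥0} (hZ : HasLaw Z (gaussianReal 0 v) P) {b σ : ℝ} (hb : 0 ≤ b) (hσ : 0 ≤ σ)
    (hv : (v : ℝ) ≤ σ ^ 2) : P {ω | b * σ < |Z ω|} ≤ ENNReal.ofReal (gaussianTail b) := by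
  rcases eq_or_ne v 0 with rfl | hv0
  · rw [gaussianReal_zero_var] at hZ
    have h0 : P {ω | b * σ < |Z ω|} = 0 := by
      rw [hZ.measure_eq (p := fun x => b * σ < |x|)
        (measurableSet_lt measurable_const measurable_abs)]
      simp only [measurableSet_lt measurable_const measurable_abs, Measure.dirac_apply']
      simp [mul_nonneg hb hσ]
    simp [h0]
  · have hvp : 0 < (v : ℝ) := by exact_mod_cast pos_iff_ne_zero.2 hv0
    have hs : 0 < √(v : ℝ) := Real.sqrt_pos.2 hvp
    have hsσ : √(v : ℝ) ≤ σ := Real.sqrt_le_iff.2 ⟨hσ, hv⟩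
    have hW : HasLaw (fun ω => Z ω / √(v : ℝ)) (gaussianReal 0 1) P := by
      have := gaussianReal_div_const hZ (√(v : ℝ))
      convert this using 2
      · simp
      · ext
        simp [Real.sq_sqrt hvp.le, hvp.ne']
    calc P {ω | b * σ < |Z ω|} ≤ P {ω | b < |Z ω / √(v : ℝ)|} := by
          refine measure_mono fun ω hω => ?_
          simp only [Set.mem_ofPred_eq] at hω ⊢
          rw [abs_div, abs_of_pos hs, lt_div_iff₀ hs]
          exact (mul_le_mul_of_nonneg_left hsσ hb).trans_lt hω
      _ = gaussianReal 0 1 {x | b < |x|} := hW.measure_eq (p := fun x => b < |x|)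
          (measurableSet_lt measurable_const measurable_abs)
      _ = ENNReal.ofReal (gaussianTail b) := by
          rw [gaussianTail, ofReal_measureReal]

/-! ### The posterior mean and variance -/

section Posterior

variable {E : Type*} {N : ℕ}

theorem gramMatrix_mulVec_apply (κ : E → E → ℝ) (X : Fin N → E) (w : Fin N → ℝ) (a : Fin N) :
    (gramMatrix κ X *ᵥ w) a = ∑ b, κ (X a) (X b) * w b := rfl

/-- A linear combination of the values of a square-integrable random function has variance equal to
the quadratic form of the Gram matrix of its covariance kernel. -/
theorem variance_sum_mul_eq {Ω : Type*} [MeasurableSpace Ω] {P : Measure Ω} [IsProbabilityMeasure P]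
    {F : Ω → E → ℝ} {κ : E → E → ℝ} (hκ : ∀ x x', κ x x' = cov[fun ω => F ω x, fun ω => F ω x'; P])
    {X : Fin N → E} (hX : ∀ a, MemLp (fun ω => F ω (X a)) 2 P) (w : Fin N → ℝ) :
    Var[fun ω => ∑ a, w a * F ω (X a); P] = w ⬝ᵥ gramMatrix κ X *ᵥ w := by
  rw [variance_fun_sum fun a => (hX a).const_mul (w a)]
  simp only [dotProduct, gramMatrix_mulVec_apply, Finset.mul_sum]
  refine Finset.sum_congr rfl fun a _ => Finset.sum_congr rfl fun b _ => ?_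
  rw [covariance_const_mul_left, covariance_const_mul_right, hκ]
  ring

theorem isUnit_add_smul_one {G : Matrix (Fin N) (Fin N) ℝ} (hG : ∀ w, 0 ≤ w ⬝ᵥ G *ᵥ w) {v : ℝ}
    (hv : 0 < v) : IsUnit (G + v • (1 : Matrix (Fin N) (Fin N) ℝ)) := by
  rw [← Matrix.mulVec_injective_iff_isUnit]
  refine (injective_iff_map_eq_zero (Matrix.mulVecLin (G + v • 1))).2 fun w hw => ?_
  have h1 : w ⬝ᵥ (G + v • (1 : Matrix (Fin N) (Fin N) ℝ)) *ᵥ w = 0 := by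
    rw [Matrix.mulVecLin_apply] at hw
    rw [hw, dotProduct_zero]
  rw [Matrix.add_mulVec, Matrix.smul_mulVec, Matrix.one_mulVec, dotProduct_add,
    dotProduct_smul, smul_eq_mul] at h1
  have h2 : 0 ≤ w ⬝ᵥ w := Finset.sum_nonneg fun i _ => mul_self_nonneg (w i)
  have h3 : w ⬝ᵥ w = 0 := by nlinarith [hG w, mul_nonneg hv.le h2]
  exact dotProduct_self_eq_zero.1 h3

/-- The weights with which the regressor at `x` combines the data. -/
noncomputable def regressionWeights (κ : E → E → ℝ) (v : ℝ) (X : Fin N → E) (x : E) : Fin N → ℝ :=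
  (gramMatrix κ X + v • (1 : Matrix (Fin N) (Fin N) ℝ))⁻¹ *ᵥ fun a => κ x (X a)

theorem posteriorMean_eq_dotProduct {κ : E → E → ℝ} (hκ : ∀ x x', κ x x' = κ x' x) (v : ℝ)
    (X : Fin N → E) (y : Fin N → ℝ) (x : E) :
    posteriorMean κ v X y x = regressionWeights κ v X x ⬝ᵥ y := by
  have hsymm : (gramMatrix κ X + v • (1 : Matrix (Fin N) (Fin N) ℝ))ᵀ =
      gramMatrix κ X + v • (1 : Matrix (Fin N) (Fin N) ℝ) := by
    rw [Matrix.transpose_add, Matrix.transpose_smul, Matrix.transpose_one]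
    congr 1
    ext a b
    exact hκ _ _
  rw [posteriorMean, regressionWeights, Matrix.dotProduct_mulVec, ← Matrix.mulVec_transpose,
    Matrix.transpose_nonsing_inv, hsymm]

/-- The error `F x - μ x` of the regressor fitted to exact values is centered Gaussian, and its
variance is at most the posterior variance (the difference is the share of the noise in the
latter). -/
theorem IsCenteredGaussianOn.exists_hasLaw_sub_posteriorMean {Ω : Type*} [MeasurableSpace Ω]
    {P : Measure Ω} [IsProbabilityMeasure P] {S : Set E} {F : Ω → E → ℝ}
    (hF : IsCenteredGaussianOn P S F) {κ : E → E → ℝ}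
    (hκ : ∀ x x', κ x x' = cov[fun ω => F ω x, fun ω => F ω x'; P]) {v : ℝ} (hv : 0 < v)
    {X : Fin N → E} (hX : ∀ a, X a ∈ S) {x : E} (hx : x ∈ S) :
    v * (regressionWeights κ v X x ⬝ᵥ regressionWeights κ v X x) ≤ κ x x ∧
    ∃ V : ℝ≥0, (V : ℝ) ≤ posteriorVar κ v X x ∧
      HasLaw (fun ω => F ω x - posteriorMean κ v X (fun a => F ω (X a)) x) (gaussianReal 0 V) P := by
  have hκs : ∀ x x', κ x x' = κ x' x := fun x x' => by rw [hκ, hκ, covariance_comm]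
  have hL2 : ∀ x ∈ S, MemLp (fun ω => F ω x) 2 P := by
    intro x hx
    obtain ⟨V, hV⟩ := hF.hasLaw_eval hx
    exact hV.hasGaussianLaw.memLp_two
  set w := regressionWeights κ v X x with hw
  simp only [posteriorMean_eq_dotProduct hκs, ← hw]
  obtain ⟨V, hV⟩ := hF (Option (Fin N)) (fun o => o.elim x X) (fun o => o.elim 1 fun a => -w a)
    (fun o => by cases o <;> simp [hx, hX])
  have hfun : (fun ω => ∑ o : Option (Fin N), (o.elim 1 fun a => -w a) * F ω (o.elim x X)) =
      fun ω => F ω x - ∑ a, w a * F ω (X a) := by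
    ext ω
    rw [Fintype.sum_option]
    simp only [Option.elim_none, Option.elim_some, one_mul, neg_mul, Finset.sum_neg_distrib,
      sub_eq_add_neg]
  rw [hfun] at hV
  have hXL : ∀ a, MemLp (fun ω => F ω (X a)) 2 P := fun a => hL2 _ (hX a)
  have hvar := hV.variance_eq
  rw [variance_id_gaussianReal, variance_fun_sub (hL2 x hx)
    (memLp_finsetSum _ fun a _ => (hXL a).const_mul (w a)),
    variance_sum_mul_eq hκ hXL, covariance_fun_sum_right (fun a => (hXL a).const_mul (w a))
    (hL2 x hx), ← covariance_self (hL2 x hx).aemeasurable, ← hκ] at hvar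
  simp only [covariance_const_mul_right, ← hκ] at hvar
  have hGw : gramMatrix κ X *ᵥ w = (fun a => κ x (X a)) - v • w := by
    have hu := isUnit_add_smul_one (G := gramMatrix κ X)
      (fun w => by rw [← variance_sum_mul_eq hκ hXL]; exact variance_nonneg _ _) hv
    have h1 : (gramMatrix κ X + v • (1 : Matrix (Fin N) (Fin N) ℝ)) *ᵥ w = fun a => κ x (X a) := by
      rw [hw, regressionWeights, Matrix.mulVec_mulVec, Matrix.mul_nonsing_inv _
        ((Matrix.isUnit_iff_isUnit_det _).1 hu), Matrix.one_mulVec]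
    rw [Matrix.add_mulVec, Matrix.smul_mulVec, Matrix.one_mulVec] at h1
    rw [← h1, add_sub_cancel_right]
  have hpv : posteriorVar κ v X x = κ x x - (fun a => κ x (X a)) ⬝ᵥ w := rfl
  rw [hGw, dotProduct_sub, dotProduct_smul, smul_eq_mul, dotProduct_comm w] at hvar
  have hsum : ∑ a, w a * κ x (X a) = (fun a => κ x (X a)) ⬝ᵥ w := dotProduct_comm _ _
  rw [hsum] at hvar
  have h2 : 0 ≤ w ⬝ᵥ w := Finset.sum_nonneg fun i _ => mul_self_nonneg (w i)
  have h3 : 0 ≤ w ⬝ᵥ gramMatrix κ X *ᵥ w := by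
    rw [← variance_sum_mul_eq hκ hXL]; exact variance_nonneg _ _
  rw [hGw, dotProduct_sub, dotProduct_smul, smul_eq_mul, dotProduct_comm w] at h3
  have h4 := mul_nonneg hv.le h2
  refine ⟨by linarith [V.2], V, ?_, hV⟩
  rw [hpv, ← hvar]
  linarith

end Posterior

/-! ### Uniform bounds -/

/-- The Gaussian tail at level `√(2 log (n / η))` is strictly below `η / n`. -/
theorem mul_gaussianTail_lt {η : ℝ} (hη0 : 0 < η) (hη1 : η < 1) (n : ℕ) :
    n * gaussianTail (√(2 * Real.log (n / η))) < η := by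
  rcases Nat.eq_zero_or_pos n with rfl | hn
  · simpa using hη0
  have hn1 : (1 : ℝ) ≤ n := by exact_mod_cast hn
  have hq : 1 < n / η := by rw [lt_div_iff₀ hη0]; linarith
  have hlog : 0 < 2 * Real.log (n / η) := by have := Real.log_pos hq; linarith
  have h1 := gaussianTail_lt (Real.sqrt_pos.2 hlog)
  rw [Real.sq_sqrt hlog.le, mul_div_cancel_left₀ _ two_ne_zero, Real.exp_neg,
    Real.exp_log (by positivity), inv_div] at h1
  calc n * gaussianTail (√(2 * Real.log (n / η))) < n * (η / n) := by gcongr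
    _ = η := by field_simp

open Filter Topology Set in
/-- The supremum of a process with continuous paths over a compact space is finite, hence bounded
by a constant up to arbitrarily small probability. -/
theorem exists_measure_exists_lt_abs_le {Ω α : Type*} [MeasurableSpace Ω] {P : Measure Ω}
    [IsProbabilityMeasure P] [TopologicalSpace α] [CompactSpace α]
    [TopologicalSpace.SeparableSpace α] {Y : Ω → α → ℝ} (hc : ∀ ω, Continuous (Y ω))
    (hm : ∀ a, AEMeasurable (fun ω => Y ω a) P) {p : ℝ} (hp : 0 < p) :
    ∃ B : ℝ, 0 ≤ B ∧ P {ω | ∃ a, B < |Y ω a|} ≤ ENNReal.ofReal p := by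
  obtain ⟨D, hDc, hDd⟩ := TopologicalSpace.exists_countable_dense α
  have hset : ∀ n : ℕ, {ω | ∃ a, (n : ℝ) < |Y ω a|} = ⋃ a ∈ D, {ω | (n : ℝ) < |Y ω a|} := by
    intro n
    ext ω
    simp only [mem_ofPred_eq, mem_iUnion, exists_prop]
    constructor
    · rintro ⟨a, ha⟩
      obtain ⟨b, hb, hbD⟩ := hDd.inter_open_nonempty _
        (isOpen_lt continuous_const (hc ω).abs : IsOpen {a | (n : ℝ) < |Y ω a|}) ⟨a, ha⟩
      exact ⟨b, hbD, hb⟩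
    · rintro ⟨a, -, ha⟩
      exact ⟨a, ha⟩
  have hnull : ∀ n : ℕ, NullMeasurableSet {ω | ∃ a, (n : ℝ) < |Y ω a|} P := by
    intro n
    rw [hset]
    refine NullMeasurableSet.biUnion hDc fun a _ => ?_
    exact nullMeasurableSet_lt aemeasurable_const (by
      simpa only [Real.norm_eq_abs] using (hm a).norm)
  have hanti : Antitone fun n : ℕ => {ω | ∃ a, (n : ℝ) < |Y ω a|} := by
    rintro m n hmn ω ⟨a, ha⟩
    exact ⟨a, lt_of_le_of_lt (by exact_mod_cast hmn) ha⟩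
  have hempty : ⋂ n : ℕ, {ω | ∃ a, (n : ℝ) < |Y ω a|} = ∅ := by
    refine eq_empty_of_forall_notMem fun ω hω => ?_
    obtain ⟨C, hC⟩ := isCompact_univ.exists_bound_of_continuousOn (hc ω).continuousOn
    obtain ⟨n, hn⟩ := exists_nat_ge C
    obtain ⟨a, ha⟩ := mem_iInter.1 hω n
    exact absurd ((hC a (mem_univ a)).trans hn) (not_le.2 ha)
  have hlim := tendsto_measure_iInter_atTop hnull hanti ⟨0, measure_ne_top P _⟩
  rw [hempty, measure_empty] at hlim
  obtain ⟨n, hn⟩ := (hlim.eventually_le_const (ENNReal.ofReal_pos.2 hp)).exists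
  exact ⟨n, Nat.cast_nonneg n, hn⟩

open Set in
/-- Only finitely many sampling instants precede `t`: consecutive states are `τ` apart, whereas
the trajectory is uniformly continuous on `[0, t]`. -/
theorem finite_setOf_sample_le {E : Type*} [NormedAddCommGroup E] {Φ : ℝ → E} {s : ℕ → ℝ}
    {t τ : ℝ} (hΦ : ContinuousOn Φ (Icc 0 t)) (hs0 : 0 ≤ s 0) (hs : StrictMono s) (hτ : 0 < τ)
    (hsample : ∀ j, s (j + 1) ≤ t → τ ≤ ‖Φ (s (j + 1)) - Φ (s j)‖) : {j | s j ≤ t}.Finite := by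
  obtain ⟨d, hd, hdu⟩ := Metric.uniformContinuousOn_iff.1
    (isCompact_Icc.uniformContinuousOn_of_continuous hΦ) τ hτ
  have hpos : ∀ j, 0 ≤ s j := fun j => hs0.trans (hs.monotone (Nat.zero_le j))
  have hstep : ∀ j, s (j + 1) ≤ t → s j + d ≤ s (j + 1) := by
    intro j hj
    by_contra! hlt
    have hjj : s j < s (j + 1) := hs j.lt_succ_self
    have := hdu (s (j + 1)) ⟨hpos _, hj⟩ (s j) ⟨hpos _, hjj.le.trans hj⟩ (by
      rw [Real.dist_eq, abs_of_pos (by linarith)]; linarith)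
    rw [dist_eq_norm] at this
    exact absurd (hsample j hj) (not_le.2 this)
  have hlin : ∀ j : ℕ, s j ≤ t → j * d ≤ s j := by
    intro j
    induction j with
    | zero => intro _; simpa using hs0
    | succ j ih =>
      intro hj
      have h1 := hstep j hj
      have h2 := ih ((hs j.lt_succ_self).le.trans hj)
      push_cast
      linarith
  obtain ⟨n, hn⟩ := exists_nat_ge (t / d)
  refine (finite_Iic n).subset fun j hj => ?_
  have h1 : (j : ℝ) ≤ t / d := by
    rw [le_div_iff₀ hd]; exact (hlin j hj).trans hj
  exact_mod_cast h1.trans hn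

theorem isCompact_tube {E : Type*} [NormedAddCommGroup E] [ProperSpace E] {Φ : ℝ → E}
    {δ a b : ℝ} (hΦ : ContinuousOn Φ (Set.Icc a b)) : IsCompact (tube Φ δ a b) := by
  have h : tube Φ δ a b =
      (fun p : ℝ × E => Φ p.1 + p.2) '' (Set.Icc a b ×ˢ Metric.closedBall 0 δ) := by
    ext x
    simp only [tube, Set.mem_iUnion, Set.mem_image, Set.mem_prod, Prod.exists, exists_prop,
      Metric.mem_closedBall, dist_eq_norm, sub_zero]
    constructor
    · rintro ⟨t, ht, hx⟩
      exact ⟨t, x - Φ t, ⟨ht, hx⟩, by abel⟩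
    · rintro ⟨t, v, ⟨ht, hv⟩, rfl⟩
      exact ⟨t, ht, by simpa using hv⟩
  rw [h]
  refine (isCompact_Icc.prod (isCompact_closedBall 0 δ)).image_of_continuousOn ?_
  exact (hΦ.comp continuousOn_fst fun p hp => hp.1).add continuousOn_snd

theorem coveringNumber_ne_top {E : Type*} [PseudoEMetricSpace E] {ρ : ℝ≥0} (hρ : 0 < ρ) {T : Set E}
    (hT : IsCompact T) : Metric.coveringNumber ρ T ≠ ⊤ := by
  obtain ⟨C, hCT, hCf, hC⟩ := Metric.exists_finite_isCover_of_isCompact hρ.ne' hT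
  exact ne_top_of_le_ne_top hCf.encard_lt_top.ne (hC.coveringNumber_le_encard hCT)

/-- The uniform error bound of Gaussian process regression with exact data: a union bound over the
centres of a minimal `ρ`-cover, extended to `T` by the Lipschitz constants.  The failure probability
is kept in terms of the exact Gaussian tail. -/
theorem IsCenteredGaussianOn.exists_measure_le_uniform_bound {Ω E : Type*} [MeasurableSpace Ω]
    {P : Measure Ω} [IsProbabilityMeasure P] [PseudoMetricSpace E] {N : ℕ} {S T : Set E}
    {F : Ω → E → ℝ} (hF : IsCenteredGaussianOn P S F) {κ : E → E → ℝ}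
    (hκ : ∀ x x', κ x x' = cov[fun ω => F ω x, fun ω => F ω x'; P]) {v : ℝ} (hv : 0 < v)
    {X : Fin N → E} (hX : ∀ a, X a ∈ S) (hT : IsCompact T) (hTS : T ⊆ S) {ρ : ℝ≥0} (hρ : 0 < ρ)
    (η : ℝ) :
    ∃ bad : Set Ω, P bad ≤ ENNReal.ofReal
        ((Metric.coveringNumber ρ T).toNat * gaussianTail (√(betaBound ρ η T))) ∧
      ∀ ω ∉ bad, ∀ Wf Wμ Wσ : ℝ≥0, LipschitzOnWith Wf (F ω) T →
        LipschitzOnWith Wμ (posteriorMean κ v X (fun a => F ω (X a))) T →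
        LipschitzOnWith Wσ (posteriorVar κ v X) T → ∀ x ∈ T,
        |posteriorMean κ v X (fun a => F ω (X a)) x - F ω x| ≤
          √(betaBound ρ η T) * √(posteriorVar κ v X x) +
            alphaBound (betaBound ρ η T) ρ Wf Wμ Wσ := by
  set β := betaBound ρ η T with hβ
  have hne := coveringNumber_ne_top hρ hT
  set C := (Metric.finite_minimalCover (ε := ρ) (A := T)).toFinset with hC
  have hCmem : ∀ c, c ∈ C ↔ c ∈ Metric.minimalCover ρ T := fun c => Set.Finite.mem_toFinset _
  have hcard : (Metric.coveringNumber ρ T).toNat = C.card := by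
    rw [← Metric.encard_minimalCover hne, hC,
      ← Set.ncard_eq_toFinset_card _ Metric.finite_minimalCover]
    rfl
  refine ⟨⋃ c ∈ C, {ω | √β * √(posteriorVar κ v X c) <
    |F ω c - posteriorMean κ v X (fun a => F ω (X a)) c|}, ?_, ?_⟩
  · refine (measure_biUnion_finset_le C _).trans ?_
    rw [hcard, ENNReal.ofReal_mul (Nat.cast_nonneg _), ENNReal.ofReal_natCast, ← nsmul_eq_mul]
    refine Finset.sum_le_card_nsmul _ _ _ fun c hc => ?_
    have hcT := Metric.minimalCover_subset ((hCmem c).1 hc)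
    obtain ⟨-, V, hV, hlaw⟩ := hF.exists_hasLaw_sub_posteriorMean hκ hv hX (hTS hcT)
    refine measure_lt_abs_le_gaussianTail hlaw (Real.sqrt_nonneg _) (Real.sqrt_nonneg _) ?_
    rwa [Real.sq_sqrt (V.2.trans hV)]
  · intro ω hω Wf Wμ Wσ hWf hWμ hWσ x hx
    obtain ⟨c, hc, hxc⟩ := Metric.isCover_minimalCover hne hx
    have hcT := Metric.minimalCover_subset hc
    have hdist : dist x c ≤ ρ := by
      rw [dist_edist]
      exact ENNReal.toReal_le_of_le_ofReal ρ.2 (by simpa using hxc)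
    have h1 : |F ω c - posteriorMean κ v X (fun a => F ω (X a)) c| ≤
        √β * √(posteriorVar κ v X c) := by
      by_contra! h
      exact hω (Set.mem_biUnion ((hCmem c).2 hc) h)
    have h2 : |F ω x - F ω c| ≤ Wf * ρ := by
      rw [← Real.dist_eq]
      exact (hWf.dist_le_mul x hx c hcT).trans (by gcongr)
    have h3 : |posteriorMean κ v X (fun a => F ω (X a)) x -
        posteriorMean κ v X (fun a => F ω (X a)) c| ≤ Wμ * ρ := by
      rw [← Real.dist_eq]
      exact (hWμ.dist_le_mul x hx c hcT).trans (by gcongr)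
    have h4 : posteriorVar κ v X c ≤ posteriorVar κ v X x + Wσ * ρ := by
      have := (hWσ.dist_le_mul x hx c hcT).trans
        (mul_le_mul_of_nonneg_left hdist Wσ.2)
      rw [Real.dist_eq] at this
      linarith [neg_abs_le (posteriorVar κ v X x - posteriorVar κ v X c)]
    have hpv : 0 ≤ posteriorVar κ v X x := by
      obtain ⟨-, V, hV, -⟩ := hF.exists_hasLaw_sub_posteriorMean hκ hv hX (hTS hx)
      exact V.2.trans hV
    have h5 : √β * √(posteriorVar κ v X c) ≤
        √β * √(posteriorVar κ v X x) + √(β * Wσ * ρ) := by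
      calc √β * √(posteriorVar κ v X c) ≤ √β * (√(posteriorVar κ v X x) + √(Wσ * ρ)) := by
            gcongr
            exact (Real.sqrt_le_sqrt h4).trans (Real.sqrt_le_iff.2 ⟨by positivity, by
              nlinarith [Real.sq_sqrt hpv, Real.sq_sqrt (by positivity : 0 ≤ (Wσ : ℝ) * ρ),
                Real.sqrt_nonneg (posteriorVar κ v X x), Real.sqrt_nonneg ((Wσ : ℝ) * ρ)]⟩)
        _ = √β * √(posteriorVar κ v X x) + √(β * Wσ * ρ) := by
            rw [mul_add, mul_assoc β, Real.sqrt_mul' β (by positivity)]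
    have h6 : posteriorMean κ v X (fun a => F ω (X a)) x - F ω x =
        (posteriorMean κ v X (fun a => F ω (X a)) x -
          posteriorMean κ v X (fun a => F ω (X a)) c) -
        (F ω c - posteriorMean κ v X (fun a => F ω (X a)) c) - (F ω x - F ω c) := by ring
    rw [h6, alphaBound]
    refine (abs_sub _ _).trans ?_
    have := abs_sub (posteriorMean κ v X (fun a => F ω (X a)) x -
          posteriorMean κ v X (fun a => F ω (X a)) c)
        (F ω c - posteriorMean κ v X (fun a => F ω (X a)) c)
    linarith

/-- The regressor is linear in the data, with weights bounded by `√(κ x x / v)`. -/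
theorem IsCenteredGaussianOn.abs_posteriorMean_sub_le {Ω E : Type*} [MeasurableSpace Ω]
    {P : Measure Ω} [IsProbabilityMeasure P] {N : ℕ} {S : Set E}
    {F : Ω → E → ℝ} (hF : IsCenteredGaussianOn P S F) {κ : E → E → ℝ}
    (hκ : ∀ x x', κ x x' = cov[fun ω => F ω x, fun ω => F ω x'; P]) {v : ℝ} (hv : 0 < v)
    {X : Fin N → E} (hX : ∀ a, X a ∈ S) {x : E} (hx : x ∈ S) {C : ℝ} (hC : κ x x ≤ C)
    {y y' : Fin N → ℝ} {e : ℝ} (he : ∀ a, |y a - y' a| ≤ e) :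
    |posteriorMean κ v X y x - posteriorMean κ v X y' x| ≤ √(C / v) * N * e := by
  have hκs : ∀ x x', κ x x' = κ x' x := fun x x' => by rw [hκ, hκ, covariance_comm]
  obtain ⟨hw, -⟩ := hF.exists_hasLaw_sub_posteriorMean hκ hv hX hx
  set w := regressionWeights κ v X x with hwdef
  rw [posteriorMean_eq_dotProduct hκs, posteriorMean_eq_dotProduct hκs, ← dotProduct_sub, ← hwdef]
  have hwa : ∀ a, |w a| ≤ √(C / v) := by
    intro a
    refine Real.abs_le_sqrt ?_
    rw [le_div_iff₀ hv, mul_comm]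
    have h1 : w a ^ 2 ≤ w ⬝ᵥ w := by
      rw [pow_two]
      exact Finset.single_le_sum (f := fun i => w i * w i) (fun i _ => mul_self_nonneg (w i))
        (Finset.mem_univ a)
    exact (mul_le_mul_of_nonneg_left h1 hv.le).trans (hw.trans hC)
  calc |w ⬝ᵥ (y - y')| ≤ ∑ a, |w a * (y - y') a| := Finset.abs_sum_le_sum_abs _ _
    _ ≤ ∑ _a : Fin N, √(C / v) * e := by
        refine Finset.sum_le_sum fun a _ => ?_
        rw [abs_mul]
        exact mul_le_mul (hwa a) (he a) (abs_nonneg _) (Real.sqrt_nonneg _)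
    _ = √(C / v) * N * e := by
        rw [Finset.sum_const, Finset.card_univ, Fintype.card_fin, nsmul_eq_mul]; ring

theorem abs_le_supNorm {w : ℝ → ℝ} (hw : ∃ B : ℝ, ∀ t, 0 ≤ t → |w t| ≤ B) {t : ℝ} (ht : 0 ≤ t) :
    |w t| ≤ supNorm w := by
  obtain ⟨B, hB⟩ := hw
  exact le_csSup ⟨B, by rintro _ ⟨t, ht, rfl⟩; exact hB t ht⟩ ⟨t, ht, rfl⟩

/-- The transient of the observer is of lower order once a fixed time has elapsed. -/
theorem pow_mul_exp_neg_le {γ tε l T : ℝ} (hγ : 0 < γ) (htε : 0 < tε) (hl : 0 < l) (hT : tε ≤ T)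
    (k r : ℕ) :
    l ^ k * Real.exp (-(γ * (l * T))) ≤ r.factorial / (γ * tε) ^ r * l ^ ((k : ℤ) - (r : ℤ)) := by
  have h1 : (γ * (l * tε)) ^ r / r.factorial ≤ Real.exp (γ * (l * tε)) :=
    Real.pow_div_factorial_le_exp _ (by positivity) r
  have h2 : Real.exp (-(γ * (l * T))) ≤ Real.exp (-(γ * (l * tε))) := by
    rw [Real.exp_le_exp]
    have : γ * (l * tε) ≤ γ * (l * T) := by gcongr
    linarith
  have h3 : Real.exp (-(γ * (l * tε))) ≤ r.factorial / (γ * (l * tε)) ^ r := by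
    rw [Real.exp_neg, inv_le_comm₀ (Real.exp_pos _) (by positivity), inv_div]
    exact h1
  rw [zpow_sub₀ hl.ne', zpow_natCast, zpow_natCast]
  calc l ^ k * Real.exp (-(γ * (l * T))) ≤ l ^ k * (r.factorial / (γ * (l * tε)) ^ r) := by
        gcongr; exact h2.trans h3
    _ = _ := by rw [mul_left_comm γ l tε, mul_pow]; field_simp

/-! ### The regression error with observer data -/

theorem theorem2 {nx nu : ℕ} {Ω : Type*} [MeasurableSpace Ω] (P : Measure Ω)
    [IsProbabilityMeasure P]
    -- the system `ẋ = f(x) + g(x) u` and its trajectory `Φ`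
    (𝒳 : Set (EuclideanSpace ℝ (Fin nx))) (h𝒳 : IsOpen 𝒳)
    (f : EuclideanSpace ℝ (Fin nx) → EuclideanSpace ℝ (Fin nx)) (hf : ContDiffOn ℝ (⊤ : ℕ∞) f 𝒳)
    (g : EuclideanSpace ℝ (Fin nx) → EuclideanSpace ℝ (Fin nu) →L[ℝ] EuclideanSpace ℝ (Fin nx))
    (hg : ContDiffOn ℝ (⊤ : ℕ∞) g 𝒳)
    (u : ℝ → EuclideanSpace ℝ (Fin nu)) (Φ : ℝ → EuclideanSpace ℝ (Fin nx))
    (hΦ_mem : ∀ t : ℝ, 0 ≤ t → Φ t ∈ 𝒳)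
    (hΦ : IsODESolution (fun t x => f x + g x (u t)) Φ)
    -- the unknown output function `h`, a smooth realization of a Gaussian process
    (h : Ω → EuclideanSpace ℝ (Fin nx) → ℝ)
    (κ₀ : EuclideanSpace ℝ (Fin nx) → EuclideanSpace ℝ (Fin nx) → ℝ)
    (hGP : IsCenteredGP P 𝒳 h κ₀)
    (hsmooth : ∀ ω, ContDiffOn ℝ (⊤ : ℕ∞) (h ω) 𝒳)
    (r k : ℕ) (hk : k < r)
    (hLg : ∀ ω, ∀ i < r, ∀ x ∈ 𝒳, ∀ v : EuclideanSpace ℝ (Fin nu),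
      fderiv ℝ ((lieDeriv f)^[i] (h ω)) x (g x v) = 0)
    -- the observer gains and the initial state of the observer
    (K : Fin r → ℝ) (hK : IsHurwitz (obsA r + Matrix.vecMulVec K (obsC r)))
    (z₀ : Fin r → ℝ)
    -- window length, noise variance of the regression, radius of the tube
    (N : ℕ) (σn2 : ℝ) (hσn2 : 0 < σn2) (δ : ℝ) (hδ : 0 < δ)
    -- the sampling instants; up to the current time `t` a new one is taken only after
    -- the state has moved by at least `τ`
    (s : ℕ → ℝ) (hs0 : 0 ≤ s 0) (hs : StrictMono s) (t τ : ℝ) (hτ : 0 < τ)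
    (hsample : ∀ j, s (j + 1) ≤ t → τ ≤ ‖Φ (s (j + 1)) - Φ (s j)‖)
    (η : ℝ) (hη0 : 0 < η) (hη1 : η < 1) (ρ : ℝ≥0) (hρ : 0 < ρ)
    (tε : ℝ) (htε : 0 < tε) :
    ∃ lstar > (0 : ℝ), ∃ c₁ > (0 : ℝ), ∃ c₂ > (0 : ℝ), ∃ c₃ > (0 : ℝ),
      ∀ l ≥ lstar,
      -- every bounded measurement noise `ε`, and the observer driven by `y = h(Φ) + ε`
      ∀ ε : Ω → ℝ → ℝ, (∀ ω, ∃ B : ℝ, ∀ t' : ℝ, 0 ≤ t' → |ε ω t'| ≤ B) →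
      ∀ zhat : Ω → ℝ → Fin r → ℝ, (∀ ω, zhat ω 0 = z₀) →
      (∀ ω, IsODESolution (fun t' z => observerField K l (h ω (Φ t') + ε ω t') z) (zhat ω)) →
      ∀ j : ℕ, N + 1 ≤ j → tε < s (j - (N + 1)) → s j ≤ t →
      tube Φ δ (s (j - (N + 1))) (s j) ⊆ 𝒳 →
      -- Lipschitz constants on the tube of `L_f^k h`, of the posterior mean, of the posterior variance
      ∀ (Wf Wμ : Ω → ℝ≥0) (Wσ : ℝ≥0),
      (∀ ω, LipschitzOnWith (Wf ω) ((lieDeriv f)^[k] (h ω))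
        (tube Φ δ (s (j - (N + 1))) (s j))) →
      (∀ ω, LipschitzOnWith (Wμ ω)
        (posteriorMean (lieKernel P f h k) σn2 (fun a => Φ (windowTime s N j a))
          (fun a => (lieDeriv f)^[k] (h ω) (Φ (windowTime s N j a))))
        (tube Φ δ (s (j - (N + 1))) (s j))) →
      LipschitzOnWith Wσ
        (posteriorVar (lieKernel P f h k) σn2 (fun a => Φ (windowTime s N j a)))
        (tube Φ δ (s (j - (N + 1))) (s j)) →
      ∃ G : Set Ω, MeasurableSet G ∧ ENNReal.ofReal (1 - η) ≤ P G ∧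
        ∀ ω ∈ G, ∀ x ∈ tube Φ δ (s (j - (N + 1))) (s j),
          |posteriorMean (lieKernel P f h k) σn2 (fun a => Φ (windowTime s N j a))
              (fun a => zhat ω (windowTime s N j a) ⟨k, hk⟩) x
            - (lieDeriv f)^[k] (h ω) x| ≤
          Real.sqrt (betaBound ρ η (tube Φ δ (s (j - (N + 1))) (s j)))
              * Real.sqrt
                (posteriorVar (lieKernel P f h k) σn2 (fun a => Φ (windowTime s N j a)) x)
            + alphaBound (betaBound ρ η (tube Φ δ (s (j - (N + 1))) (s j))) ρ (Wf ω) (Wμ ω) Wσ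
            + c₁ * N * max (c₂ * l ^ k * supNorm (ε ω)) (c₃ * l ^ ((k : ℤ) - (r : ℤ))) := by
  have hr : 0 < r := by omega
  set κ := lieKernel P f h k with hκdef
  have hκ : ∀ x x', κ x x' =
      cov[fun ω => (lieDeriv f)^[k] (h ω) x, fun ω => (lieDeriv f)^[k] (h ω) x'; P] :=
    fun _ _ => rfl
  have hG : ∀ i, IsCenteredGaussianOn P 𝒳 (fun ω => (lieDeriv f)^[i] (h ω)) := fun i =>
    hGP.isCenteredGaussianOn.lieDeriv_iterate h𝒳 hsmooth hf i
  have hcontF : ∀ i ω, ContinuousOn ((lieDeriv f)^[i] (h ω)) 𝒳 := fun i ω =>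
    (contDiffOn_lieDeriv_iterate h𝒳 hf (hsmooth ω) i).continuousOn
  have hspos : ∀ i, 0 ≤ s i := fun i => hs0.trans (hs.monotone (Nat.zero_le i))
  have hΦc : ContinuousOn Φ (Set.Icc 0 t) := hΦ.continuousOn t
  have hJ : {j | s j ≤ t}.Finite := finite_setOf_sample_le hΦc hs0 hs hτ hsample
  set T : ℕ → Set (EuclideanSpace ℝ (Fin nx)) := fun j => tube Φ δ (s (j - (N + 1))) (s j)
    with hTdef
  have hTc : ∀ j, IsCompact (T j) := fun j =>
    isCompact_tube ((hΦ.continuousOn (s j)).mono (Set.Icc_subset_Icc_left (hspos _)))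
  -- a bound of the prior variance on all the tubes
  obtain ⟨C, hC⟩ : ∃ C : ℝ, ∀ j, s j ≤ t → T j ⊆ 𝒳 → ∀ x ∈ T j, κ x x ≤ C := by
    have h1 : ∀ j, ∃ C : ℝ, T j ⊆ 𝒳 → ∀ x ∈ T j, κ x x ≤ C := by
      intro j
      by_cases hj : T j ⊆ 𝒳
      · obtain ⟨C, hC⟩ := (hG k).exists_variance_le (hcontF k) (hTc j) hj
        refine ⟨C, fun _ x hx => ?_⟩
        obtain ⟨V, hV⟩ := (hG k).hasLaw_eval (hj hx)
        rw [hκ, covariance_self hV.aemeasurable]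
        exact hC x hx
      · exact ⟨0, fun h => absurd h hj⟩
    choose C hC using h1
    obtain ⟨C', hC'⟩ := ((Filter.eventually_all_finite hJ).2
      fun j _ => Filter.eventually_ge_atTop (C j)).exists
    exact ⟨C', fun j hj hT x hx => (hC j hT x hx).trans (hC' j hj)⟩
  -- the slack in the tail estimate, uniform in the finitely many windows
  obtain ⟨p, hp, hp0⟩ : ∃ p : ℝ, (∀ j, s j ≤ t → p ≤ η - (Metric.coveringNumber ρ (T j)).toNat *
      gaussianTail (√(betaBound ρ η (T j)))) ∧ 0 < p := by
    have h1 := (Filter.eventually_all_finite hJ).2 fun j _ =>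
      (eventually_le_nhds (sub_pos.2 (mul_gaussianTail_lt hη0 hη1
        (Metric.coveringNumber ρ (T j)).toNat))).filter_mono
          (nhdsWithin_le_nhds (s := Set.Ioi (0 : ℝ)))
    exact (h1.and eventually_mem_nhdsWithin).exists
  -- the derivatives of the output along the trajectory are bounded up to that probability
  obtain ⟨B, hB0, hB⟩ := exists_measure_exists_lt_abs_le (P := P)
    (Y := fun ω (a : Fin (r + 1) × Set.Icc 0 t) => (lieDeriv f)^[a.1] (h ω) (Φ a.2))
    (fun ω => continuous_prod_of_discrete_left.2 fun i =>
      continuousOn_iff_continuous_domRestrict.1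
        ((hcontF i ω).comp hΦc fun s hs => hΦ_mem s hs.1))
    (fun a => by
      obtain ⟨V, hV⟩ := (hG a.1).hasLaw_eval (hΦ_mem a.2 a.2.2.1)
      exact hV.aemeasurable) hp0
  obtain ⟨c, hc, γ, hγ, hobs⟩ := hK.exists_observer_error_le hr
  set D := (r.factorial : ℝ) / (γ * tε) ^ r with hD
  have hD0 : 0 < D := by positivity
  -- the factors `2` turn a sum into a maximum, `a + b ≤ max (2 a) (2 b)`; the summands `1` only
  -- make the constants positive
  refine ⟨1, one_pos, √((max C 0 + 1) / σn2), Real.sqrt_pos.2 (by positivity), 2 * c, by positivity,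
    2 * c * (B + D * (‖z₀‖ + B) + 1), by positivity, ?_⟩
  intro l hl ε hε zhat hz0 hzhat j hjN hjtε hjt hjT Wf Wμ Wσ hWf hWμ hWσ
  have hl0 : 0 < l := by linarith
  have hwin : ∀ a : Fin N, windowTime s N j a ∈ Set.Icc (s (j - (N + 1))) (s j) := by
    intro a
    have := a.2
    exact ⟨hs.monotone (by omega), hs.monotone (by omega)⟩
  have hXS : ∀ a : Fin N, Φ (windowTime s N j a) ∈ 𝒳 := fun a =>
    hΦ_mem _ ((hspos _).trans (hwin a).1)
  obtain ⟨bad, hbad, hgood⟩ := (hG k).exists_measure_le_uniform_bound hκ hσn2 hXS (hTc j) hjT hρ η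
  set bad' := {ω | ∃ a : Fin (r + 1) × Set.Icc 0 t, B < |(lieDeriv f)^[a.1] (h ω) (Φ a.2)|}
    with hbad'
  have hPbad : P (bad ∪ bad') ≤ ENNReal.ofReal η := by
    refine (measure_union_le _ _).trans ((add_le_add hbad hB).trans ?_)
    rw [← ENNReal.ofReal_add (mul_nonneg (Nat.cast_nonneg _) (gaussianTail_nonneg _)) hp0.le]
    exact ENNReal.ofReal_le_ofReal (by linarith [hp j hjt])
  refine ⟨(toMeasurable P (bad ∪ bad'))ᶜ, (measurableSet_toMeasurable _ _).compl, ?_, ?_⟩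
  · rw [prob_compl_eq_one_sub (measurableSet_toMeasurable _ _), measure_toMeasurable,
      ENNReal.ofReal_sub _ hη0.le, ENNReal.ofReal_one]
    exact tsub_le_tsub_left hPbad 1
  intro ω hω x hx
  have hω' : ω ∉ bad ∪ bad' := fun h => hω (subset_toMeasurable _ _ h)
  have hωB : ∀ i ≤ r, ∀ s ∈ Set.Icc 0 t, |(lieDeriv f)^[i] (h ω) (Φ s)| ≤ B := by
    intro i hi s hs
    by_contra! hlt
    exact hω' (Or.inr ⟨(⟨i, by omega⟩, ⟨s, hs⟩), hlt⟩)
  set e := supNorm (ε ω) with he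
  have he0 : 0 ≤ e := (abs_nonneg _).trans (abs_le_supNorm (hε ω) le_rfl)
  have hinit : ‖fun i : Fin r => zhat ω 0 i - (lieDeriv f)^[i] (h ω) (Φ 0)‖ ≤ ‖z₀‖ + B := by
    have ht0 : (0 : ℝ) ∈ Set.Icc 0 t := ⟨le_rfl, (hspos j).trans hjt⟩
    refine (pi_norm_le_iff_of_nonneg (by positivity)).2 fun i => ?_
    rw [hz0 ω, Real.norm_eq_abs]
    exact (abs_sub _ _).trans (add_le_add (norm_le_pi_norm z₀ i) (hωB i i.2.le 0 ht0))
  have herr : ∀ a : Fin N, |zhat ω (windowTime s N j a) ⟨k, hk⟩ -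
      (lieDeriv f)^[k] (h ω) (Φ (windowTime s N j a))| ≤
        max (2 * c * l ^ k * e) (2 * c * (B + D * (‖z₀‖ + B) + 1) * l ^ ((k : ℤ) - (r : ℤ))) := by
    intro a
    obtain ⟨ha1, ha2⟩ := hwin a
    set θ := windowTime s N j a with hθ
    have hθ0 : 0 ≤ θ := (hspos _).trans ha1
    have h1 := hobs l hl (fun i t' => (lieDeriv f)^[i] (h ω) (Φ t')) (ε ω) (zhat ω) θ e B hθ0
      (fun i hi t' ht' => by
        have h2 := IsODESolution.eq_add_integral_lieDeriv h𝒳 hΦ_mem hΦ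
          (contDiffOn_lieDeriv_iterate h𝒳 hf (hsmooth ω) i) (hLg ω i hi) ht'
        simpa only [Function.iterate_succ_apply'] using h2)
      (hzhat ω) (fun s hs => abs_le_supNorm (hε ω) hs.1)
      (fun s hs => hωB r le_rfl s ⟨hs.1, hs.2.trans (ha2.trans hjt)⟩) ⟨k, hk⟩
    have h2 := pow_mul_exp_neg_le hγ htε hl0 (hjtε.le.trans ha1) k r
    have hlz : 0 < l ^ ((k : ℤ) - (r : ℤ)) := zpow_pos hl0 _
    refine h1.trans ?_
    calc c * (l ^ k * e + l ^ ((k : ℤ) - (r : ℤ)) * B + l ^ k * Real.exp (-(γ * (l * θ))) *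
          ‖fun i : Fin r => zhat ω 0 i - (lieDeriv f)^[i] (h ω) (Φ 0)‖)
        ≤ c * (l ^ k * e + l ^ ((k : ℤ) - (r : ℤ)) * B +
          D * l ^ ((k : ℤ) - (r : ℤ)) * (‖z₀‖ + B)) := by gcongr
      _ ≤ (2 * c * l ^ k * e + 2 * c * (B + D * (‖z₀‖ + B) + 1) * l ^ ((k : ℤ) - (r : ℤ))) / 2 := by
          nlinarith [mul_pos hc hlz]
      _ ≤ _ := by
          linarith [le_max_left (2 * c * l ^ k * e)
            (2 * c * (B + D * (‖z₀‖ + B) + 1) * l ^ ((k : ℤ) - (r : ℤ))),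
            le_max_right (2 * c * l ^ k * e)
            (2 * c * (B + D * (‖z₀‖ + B) + 1) * l ^ ((k : ℤ) - (r : ℤ)))]
  have hreg := (hG k).abs_posteriorMean_sub_le hκ hσn2 hXS (hjT hx)
    ((hC j hjt hjT x hx).trans ((le_max_left C 0).trans (by linarith : max C 0 ≤ max C 0 + 1))) herr
  have hunif := hgood ω (fun h => hω' (Or.inl h)) (Wf ω) (Wμ ω) Wσ (hWf ω) (hWμ ω) hWσ x hx
  refine (abs_sub_le _ (posteriorMean κ σn2 (fun a => Φ (windowTime s N j a))
    (fun a => (lieDeriv f)^[k] (h ω) (Φ (windowTime s N j a))) x) _).trans ?_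
  linarith
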